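/- **Setting.** Fix $d,M\ge 0$, $T\ge 1$, a set of contexts $\mathcal X$, contexts $x_1,\dots,x_T\in\mathcal X$, and nonempty action sets $\mathcal A_1,\dots,\mathcal A_T\subseteq\mathcal A=\{a\in\mathbb R^d:\|a\|\le 1\}$ (an oblivious adversary). Let $\mu:\mathcal A\times\mathcal X\to[-1,1]$ be the mean loss function, $\mathcal F$ a nonempty class of functions $f:\mathcal X\to\mathbb R^d$, and $$\varepsilon_T=\inf_{f\in\mathcal F}\Big(\frac1T\sum_{t=1}^T\sup_{a\in\mathcal A_t}(\langle a,f(x_t)\rangle-\mu(a,x_t))^2\Big)^{1/2}.$$ **Oracle.** A weighted regression oracle is a randomized algorithm which, in each round, receives a context $x$ and a weight $w\ge0$, outputs $\hat y\in\mathbb R^d$, and then observes an action $a\in\mathcal A$ and a loss $\ell\in[-1,1]$. Assume that for some constant $\mathrm{Reg}_{Sq}(T)\ge 0$ and every adaptively chosen sequence $(w_t,x_t,a_t,\ell_t)_{t=1}^T$, $$\mathbb E\Big[\sum_{t=1}^T w_t(\langle a_t,\hat y_t\rangle-\ell_t)^2-\inf_{f\in\mathcal F}\sum_{t=1}^T w_t(\langle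 a_t,f(x_t)\rangle-\ell_t)^2\Big]\le\mathbb E\big[\max_{t\le T}w_t\big]\,\mathrm{Reg}_{Sq}(T).$$ **Algorithm.** There are $M$ base algorithms (SquareCB.Lin+), each with its own copy of the oracle; put $\varepsilon'_m=e^{-m}$, $m=1,\dots,M$. In round $t$ an arbitrary master algorithm chooses, from the past, a distribution $q_t$ on $\{1,\dots,M\}$ with all $q_{t,m}>0$ and draws $A_t\sim q_t$. Let $\rho_{t,m}=1/\min_{s\le t}q_{s,m}$ and $$\gamma_{t,m}=\min\Big\{\frac{\sqrt d}{\varepsilon'_m},\sqrt{\frac{dT}{\rho_{t,m}\mathrm{Reg}_{Sq}(T)}}\Big\}$$ (the second term is $+\infty$ if $\mathrm{Reg}_{Sq}(T)=0$). With $m=A_t$, base algorithm $m$ queries its oracle with $x_t$ and weight $w_t=\gamma_{t,m}/q_{t,m}$, obtains $\hat\theta_t$, draws $a_t\sim p_t$, observes a loss $\ell_t\in[-1,1]$ whose conditional mean given the past, $A_t$, $\hat\theta_t$ and $a_t$ is $\mu(a_t,x_t)$, and updates its oracle with $(w_t,x_t,a_t,\ell_t)$; the other base algorithms and their oracles remain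 unchanged. Here $p_t$ is any minimizer (assumed to exist) of $$p\mapsto\langle\bar a_p,\hat\theta_t\rangle-\gamma_{t,m}^{-1}\log\det(H_p-\bar a_p\bar a_p^\top)$$ over the distributions $p$ on $\mathcal A_t$ with countable support, where $\bar a_p=\mathbb E_{a\sim p}[a]$, $H_p=\mathbb E_{a\sim p}[aa^\top]$, and $\det$ stands for the product of the $\dim(\mathcal A_t)$ largest eigenvalues, $\dim(\mathcal A_t)$ being the dimension of the affine hull of $\mathcal A_t$. **Theorem.** For every $m\in\{1,\dots,M\}$ the importance-weighted regret $$\mathrm{Reg}_{Imp}(m)=\mathbb E\Big[\sum_{t=1}^T\frac{\mathbb 1\{A_t=m\}}{q_{t,m}}\Big(\mu(a_t,x_t)-\inf_{a\in\mathcal A_t}\mu(a,x_t)\Big)\Big]$$ satisfies $$\mathrm{Reg}_{Imp}(m)\le\frac32\,\mathbb E\big[\sqrt{\rho_{T,m}}\big]\sqrt{dT\,\mathrm{Reg}_{Sq}(T)}+\Big(\Big(\varepsilon'_m+\frac{\varepsilon_T^2}{\varepsilon'_m}\Big)\sqrt d+2\varepsilon_T\Big)T,$$ where $0\cdot\infty=0$.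 For $\varepsilon_T>0$ the last term equals $\big(\big(\frac{\varepsilon'_m}{\varepsilon_T}+\frac{\varepsilon_T}{\varepsilon'_m}\big)\sqrt d+2\big)\varepsilon_T T$. -/

import Mathlib

open MeasureTheory ProbabilityTheory
open scoped ENNReal NNReal

namespace CorralCB

noncomputable section

/-- The ambient Euclidean space of actions and of parameter vectors. -/
abbrev E (d : ℕ) : Type := EuclideanSpace ℝ (Fin d)

/-! ### The log-determinant barrier -/

/-- The mean action `𝔼_{a ∼ p}[a]`. A `PMF` is a distribution with countable support. -/
def meanAction {d : ℕ} (p : PMF (E d)) : E d := ∫ a, a ∂p.toMeasure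

/-- The second moment matrix `H_p = 𝔼_{a ∼ p}[a aᵀ]`. -/
def secondMoment {d : ℕ} (p : PMF (E d)) : Matrix (Fin d) (Fin d) ℝ :=
  Matrix.of fun i j => ∫ a, a i * a j ∂p.toMeasure

/-- The matrix `H_p - ā_p ā_pᵀ`. -/
def covMatrix {d : ℕ} (p : PMF (E d)) : Matrix (Fin d) (Fin d) ℝ :=
  secondMoment p - Matrix.vecMulVec (meanAction p) (meanAction p)

theorem covMatrix_isHermitian {d : ℕ} (p : PMF (E d)) : (covMatrix p).IsHermitian := by
  ext i j
  simp [covMatrix, secondMoment, Matrix.vecMulVec_apply, mul_comm]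

/-- `dim(𝒜)`: the dimension of the smallest affine subspace containing `S`. -/
def affDim {d : ℕ} (S : Set (E d)) : ℕ := Module.finrank ℝ (vectorSpan ℝ S)

/-- The determinant of `H_p - ā_p ā_pᵀ` relative to the action set `S`: the product of the first
(i.e. largest; `eigenvalues₀` lists them in decreasing order, with multiplicity) `dim(S)`
eigenvalues. For `dim(S) = d` it is the determinant. -/
def covDet {d : ℕ} (S : Set (E d)) (p : PMF (E d)) : ℝ :=
  ∏ i : Fin (Fintype.card (Fin d)) with i.val < affDim S, (covMatrix_isHermitian p).eigenvalues₀ i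

/-- The objective `⟨ā_p, θ⟩ - γ⁻¹ log det(H_p - ā_p ā_pᵀ)`, where the determinant is positive. -/
def logdetObjective {d : ℕ} (θ : E d) (γ : ℝ) (S : Set (E d)) (p : PMF (E d)) : ℝ :=
  inner ℝ (meanAction p) θ - γ⁻¹ * Real.log (covDet S p)

/-- `p` is a minimizer of the objective over all countably supported distributions on `S`.
The objective is `+∞` where the determinant is `0` (it is never negative), and there is a
distribution on `S` with positive determinant, so that a minimizer has a positive determinant and
only such competitors matter. -/
def IsLogdetBarrier {d : ℕ} (θ : E d) (γ : ℝ) (S : Set (E d)) (p : PMF (E d)) : Prop :=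
  p.support ⊆ S ∧ 0 < covDet S p ∧
    ∀ p' : PMF (E d), p'.support ⊆ S → 0 < covDet S p' →
      logdetObjective θ γ S p ≤ logdetObjective θ γ S p'

/-! ### Weighted online regression oracles -/

/-- One round of the oracle protocol, `((x, w), (ŷ, (a, ℓ)))`: context and weight, prediction,
action and loss. -/
abbrev Record (𝒳 : Type*) (d : ℕ) := (𝒳 × ℝ) × (E d × (E d × ℝ))

/-- A randomized weighted regression oracle: in its `n`-th round (from `0`), given the record of
the `n` previous rounds (own predictions included) and the current context and weight, it draws
its prediction from `kernel n`. -/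
structure WeightedOracle (𝒳 : Type*) [MeasurableSpace 𝒳] (d : ℕ) where
  kernel : (n : ℕ) → Kernel ((Fin n → Record 𝒳 d) × (𝒳 × ℝ)) (E d)
  isMarkov : ∀ n, IsMarkovKernel (kernel n)

/-- `Q` is the law of a `T`-round interaction of the oracle with an adaptive (possibly randomized)
environment: the prediction of round `n` is drawn from the oracle's kernel given everything on
record up to the context and weight of that round, and otherwise the environment chooses contexts,
nonnegative weights, actions in the unit ball and losses in `[-1, 1]` as it likes, depending on the
record (the action and the loss of a round also on the prediction of that round). -/
structure WeightedOracle.IsRun {𝒳 : Type*} [MeasurableSpace 𝒳] {d : ℕ}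
    (orc : WeightedOracle 𝒳 d) (T : ℕ) (Q : Measure (Fin T → Record 𝒳 d)) : Prop where
  isProb : IsProbabilityMeasure Q
  pred_law : ∀ n : Fin T,
    Q.map (fun r => ((fun i : Fin n => r (Fin.castLE n.isLt.le i), (r n).1), (r n).2.1)) =
      (Q.map fun r => (fun i : Fin n => r (Fin.castLE n.isLt.le i), (r n).1)) ⊗ₘ orc.kernel n
  weight_nonneg : ∀ᵐ r ∂Q, ∀ n, 0 ≤ (r n).1.2
  action_mem : ∀ᵐ r ∂Q, ∀ n, (r n).2.2.1 ∈ Metric.closedBall (0 : E d) 1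
  loss_mem : ∀ᵐ r ∂Q, ∀ n, (r n).2.2.2 ∈ Set.Icc (-1 : ℝ) 1

/-- The oracle has weighted square loss regret at most `R` against `F` over `T` rounds:
`𝔼[∑ wₙ (⟨aₙ, ŷₙ⟩ - ℓₙ)² - inf_{f ∈ F} ∑ wₙ (⟨aₙ, f xₙ⟩ - ℓₙ)²] ≤ 𝔼[max wₙ] R`
for every adaptively chosen sequence. The subtracted term is moved to the other side, so that all
expectations are those of nonnegative quantities. -/
def WeightedOracle.HasRegret {𝒳 : Type*} [MeasurableSpace 𝒳] {d : ℕ}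
    (orc : WeightedOracle 𝒳 d) (F : Set (𝒳 → E d)) (T : ℕ) (R : ℝ≥0) : Prop :=
  ∀ Q : Measure (Fin T → Record 𝒳 d), orc.IsRun T Q →
    ∫⁻ r, ENNReal.ofReal
        (∑ n, (r n).1.2 * (inner ℝ (r n).2.2.1 (r n).2.1 - (r n).2.2.2) ^ 2) ∂Q
      ≤ ∫⁻ r, ENNReal.ofReal
          (⨅ f : F, ∑ n, (r n).1.2 * (inner ℝ (r n).2.2.1 (f.1 (r n).1.1) - (r n).2.2.2) ^ 2) ∂Q
        + (∫⁻ r, ⨆ n, ENNReal.ofReal (r n).1.2 ∂Q) * R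

/-! ### Misspecification -/

/-- The average misspecification level
`ε_T(S) = inf_{f ∈ F} (1/T ∑ₜ sup_{a ∈ 𝒜ₜ} (⟨a, f xₜ⟩ - μ(a, xₜ))²)^{1/2}`. -/
def misspec {𝒳 : Type*} {d : ℕ} (F : Set (𝒳 → E d)) (μ : E d → 𝒳 → ℝ) (T : ℕ)
    (x : ℕ → 𝒳) (𝒜 : ℕ → Set (E d)) : ℝ :=
  ⨅ f : F, √((1 / (T : ℝ)) * ∑ t ∈ Finset.range T,
    ⨆ a : 𝒜 t, (inner ℝ a.1 (f.1 (x t)) - μ a.1 (x t)) ^ 2)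

/-- `ε'_m = exp(-m)` for `m = 1, …, M` (the index of type `Fin M` starts at `0`). -/
def gridEps {M : ℕ} (m : Fin M) : ℝ := Real.exp (-((m : ℝ) + 1))

/-! ### The corralling scheme with base algorithms SquareCB.Lin+

Rounds are numbered `0, …, T - 1`. -/

/-- The random quantities of the scheme: the master's distribution `q t` over the base algorithms,
the index `A t` of the selected one, the prediction `pred t` which the oracle of that base algorithm
makes, the distribution `p t` from which the action `act t` is drawn, and the loss. The σ-algebra
`ℱ t` is the information available before `A t` is drawn (it may contain private randomness of the
master). -/
structure Scheme (Ω : Type*) [mΩ : MeasurableSpace Ω] (d M : ℕ) where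
  ℱ : Filtration ℕ mΩ
  q : ℕ → Ω → Fin M → ℝ
  A : ℕ → Ω → Fin M
  pred : ℕ → Ω → E d
  p : ℕ → Ω → PMF (E d)
  act : ℕ → Ω → E d
  loss : ℕ → Ω → ℝ

namespace Scheme

variable {Ω : Type*} [mΩ : MeasurableSpace Ω] {d M : ℕ}

/-- `ρ_{t,m} = 1 / min_{s ≤ t} q_{s,m}`. -/
def rho (S : Scheme Ω d M) (t : ℕ) (m : Fin M) (ω : Ω) : ℝ :=
  1 / (Finset.range (t + 1)).inf' Finset.nonempty_range_add_one (fun s => S.q s ω m)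

/-- The learning rate `γ_{t,m} = min {√d / ε'_m, √(d T / (ρ_{t,m} R))}`, where the second term is
`+∞` if `R = 0`. -/
def gamma (S : Scheme Ω d M) (T : ℕ) (R : ℝ≥0) (t : ℕ) (m : Fin M) (ω : Ω) : ℝ :=
  if R = 0 then √d / gridEps m
  else min (√d / gridEps m) √(d * T / (S.rho t m ω * R))

/-- The weight `w_t = γ_{t,m} / q_{t,m}`. -/
def weight (S : Scheme Ω d M) (T : ℕ) (R : ℝ≥0) (t : ℕ) (m : Fin M) (ω : Ω) : ℝ :=
  S.gamma T R t m ω / S.q t ω m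

/-- What the oracle of the selected base algorithm has on record about round `t`. -/
def record {𝒳 : Type*} (S : Scheme Ω d M) (T : ℕ) (R : ℝ≥0) (x : ℕ → 𝒳) (t : ℕ) (ω : Ω) :
    Record 𝒳 d :=
  ((x t, S.weight T R t (S.A t ω) ω), (S.pred t ω, (S.act t ω, S.loss t ω)))

/-- The law of the prediction which the oracle of base algorithm `m` makes if this algorithm is
selected in round `t`. That oracle has seen exactly the earlier rounds in which `m` was selected:
there are `Nat.count _ t` of them, and `Nat.nth _ i` is the `i`-th one. -/
def predLaw {𝒳 : Type*} [MeasurableSpace 𝒳] (S : Scheme Ω d M) (orc : WeightedOracle 𝒳 d)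
    (T : ℕ) (R : ℝ≥0) (x : ℕ → 𝒳) (t : ℕ) (m : Fin M) (ω : Ω) : Measure (E d) :=
  orc.kernel (Nat.count (fun s => S.A s ω = m) t)
    (fun i => S.record T R x (Nat.nth (fun s => S.A s ω = m) i) ω, (x t, S.weight T R t m ω))

/-- The information after the base algorithm of round `t` has been selected. -/
abbrev afterSelect (S : Scheme Ω d M) (t : ℕ) : MeasurableSpace Ω :=
  S.ℱ t ⊔ MeasurableSpace.comap (S.A t) inferInstance

/-- The information after the oracle's prediction in round `t`. -/
abbrev afterPred (S : Scheme Ω d M) (t : ℕ) : MeasurableSpace Ω :=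
  S.afterSelect t ⊔ MeasurableSpace.comap (S.pred t) inferInstance

/-- The information after the action of round `t` has been chosen. -/
abbrev afterAct (S : Scheme Ω d M) (t : ℕ) : MeasurableSpace Ω :=
  S.afterPred t ⊔ MeasurableSpace.comap (S.act t) inferInstance

/-- The information after the loss of round `t` has been observed. -/
abbrev afterLoss (S : Scheme Ω d M) (t : ℕ) : MeasurableSpace Ω :=
  S.afterAct t ⊔ MeasurableSpace.comap (S.loss t) inferInstance

end Scheme

/-- The conditional law of `X` given `𝒢` is `κ`:
`𝔼[g(X) | 𝒢] = ∫ g dκ` a.s. for all bounded measurable `g`. -/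
def HasCondLaw {Ω β : Type*} [MeasurableSpace Ω] [MeasurableSpace β] (P : Measure Ω)
    (𝒢 : MeasurableSpace Ω) (X : Ω → β) (κ : Ω → Measure β) : Prop :=
  ∀ g : β → ℝ, Measurable g → (∃ C, ∀ b, |g b| ≤ C) →
    P[fun ω => g (X ω) | 𝒢] =ᵐ[P] fun ω => ∫ b, g b ∂κ ω

/-- The corralling scheme, run for `T` rounds under `P` with an arbitrary master and with the base
algorithms SquareCB.Lin+ with parameters `T` and `R`, each of which has its own copy of the
oracle, on the fixed sequence `(x t, 𝒜 t)` with mean loss function `μ`. -/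
structure Scheme.IsRun {𝒳 Ω : Type*} [MeasurableSpace 𝒳] [MeasurableSpace Ω] {d M : ℕ}
    (S : Scheme Ω d M) (P : Measure Ω) (orc : WeightedOracle 𝒳 d) (T : ℕ) (R : ℝ≥0)
    (μ : E d → 𝒳 → ℝ) (x : ℕ → 𝒳) (𝒜 : ℕ → Set (E d)) : Prop where
  measurable_A : ∀ t < T, Measurable (S.A t)
  measurable_pred : ∀ t < T, Measurable (S.pred t)
  measurable_act : ∀ t < T, Measurable (S.act t)
  measurable_loss : ∀ t < T, Measurable (S.loss t)
  /-- The history grows by what happens in each round. -/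
  history : ∀ t < T, S.afterLoss t ≤ S.ℱ (t + 1)
  /-- The master's distributions. -/
  q_measurable : ∀ t < T, ∀ m, Measurable[S.ℱ t] fun ω => S.q t ω m
  q_pos : ∀ t < T, ∀ ω m, 0 < S.q t ω m
  q_sum : ∀ t < T, ∀ ω, ∑ m, S.q t ω m = 1
  /-- `A_t ∼ q_t`. -/
  select : ∀ t < T, ∀ m, P⟦S.A t ⁻¹' {m} | S.ℱ t⟧ =ᵐ[P] fun ω => S.q t ω m
  /-- The oracle of the selected base algorithm makes its prediction. -/
  predict : ∀ t < T, HasCondLaw P (S.afterSelect t) (S.pred t)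
    fun ω => S.predLaw orc T R x t (S.A t ω) ω
  /-- `p_t` is any solution of the log-determinant barrier problem. -/
  barrier : ∀ t < T, ∀ ω,
    IsLogdetBarrier (S.pred t ω) (S.gamma T R t (S.A t ω) ω) (𝒜 t) (S.p t ω)
  /-- `a_t ∼ p_t`. -/
  act_law : ∀ t < T, HasCondLaw P (S.afterPred t) (S.act t) fun ω => (S.p t ω).toMeasure
  act_mem : ∀ t < T, ∀ ω, S.act t ω ∈ 𝒜 t
  /-- The loss lies in `[-1, 1]` and has conditional mean `μ(a_t, x_t)`. -/
  loss_mem : ∀ t < T, ∀ ω, S.loss t ω ∈ Set.Icc (-1 : ℝ) 1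
  loss_mean : ∀ t < T, P[S.loss t | S.afterAct t] =ᵐ[P] fun ω => μ (S.act t ω) (x t)

/-- The importance-weighted regret
`𝔼[∑ₜ 1{A_t = m} / q_{t,m} (μ(a_t, x_t) - inf_{a ∈ 𝒜ₜ} μ(a, x_t))]`, the expectation of a
nonnegative random variable. -/
def Scheme.regImp {𝒳 Ω : Type*} [MeasurableSpace Ω] {d M : ℕ} (S : Scheme Ω d M)
    (P : Measure Ω) (T : ℕ) (μ : E d → 𝒳 → ℝ) (x : ℕ → 𝒳) (𝒜 : ℕ → Set (E d)) (m : Fin M) :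
    ℝ≥0∞ :=
  ∫⁻ ω, ENNReal.ofReal (∑ t ∈ Finset.range T,
    (if S.A t ω = m then 1 else 0) / S.q t ω m *
      (μ (S.act t ω) (x t) - ⨅ a : 𝒜 t, μ a.1 (x t))) ∂P

end

end CorralCB

/-!
The regret is reduced to the squared prediction error of the oracle, round by round, and the regret
of the oracle then bounds the sum of these errors.

*One round.* Let `p` minimize the log-determinant barrier for the prediction `θ`, with mean `ā` and
covariance matrix `Σ`. Moving the mass `η` to an action `a` changes `Σ` into `(1 - η) (Σ + η c cᵀ)`,
where `c = a - ā`. By the matrix determinant lemma `log det` then grows, to first order in `η`, by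
at least `η (cᵀ (s + Σ)⁻¹ c - dim)` for every `s > 0`, so that optimality gives
`cᵀ (s + Σ)⁻¹ c ≤ γ ⟨c, θ⟩ + d` (`IsLogdetBarrier.inv_quadForm_le`). The shift by `s` makes sense of
the inverse when the action set spans a proper subspace. The Cauchy–Schwarz inequality for
`(s + Σ)⁻¹` and `s + Σ`, with `s → 0`, turns this into
`⟨ā - a, θ'⟩ ≤ d / γ + γ / 4 · 𝔼_{b ∼ p} ⟨b, θ - θ'⟩²` for every `θ'`
(`IsLogdetBarrier.inner_sub_le`), applied with `θ' = f(x_t)` for a fixed `f` in the class. Replacing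
`μ` by the linear losses of `f` costs twice the largest error of `f`.

*The oracle.* The importance weights undo the random selection of the base algorithm, so that
`d / γ` contributes its plain expectation, and the squared errors appear with the weights `γ / q` of
the oracle. The oracle of base algorithm `m` sees only a random number of rounds. Its record is
filled up with rounds of zero weight, whose predictions are redrawn from the kernel of the oracle;
this gives a full run of `T` rounds with the same weighted losses
(`WeightedOracle.exists_completion`), to which the regret bound applies
(`Scheme.IsRun.lintegral_loss_le`). The choice of `γ` bounds the weights by
`max w · Reg_Sq ≤ √(d T ρ Reg_Sq)`.

*Misspecification.* With `u = ⟨a, θ̂ - f(x)⟩` and `e = ⟨a, f(x)⟩ - μ(a, x)`, the difference of the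
squared losses of the oracle and of `f` has conditional mean `u² + 2 u e ≥ u² / 2 - 2 e²`. The
weights of the terms `e²` have expectation at most `√d / ε'_m`, which yields
`Scheme.IsRun.sum_lintegral_sq_le`. The infimum over `f` is taken at the end, where it need not be
attained.
-/

namespace CorralCB

open Matrix Filter Topology

/-! ### Resolvents of positive semidefinite matrices -/

theorem posDef_smul_one_add {n : Type*} [Fintype n] [DecidableEq n] {A : Matrix n n ℝ}
    (hA : A.PosSemidef) {s : ℝ} (hs : 0 < s) : (s • (1 : Matrix n n ℝ) + A).PosDef :=
  (Matrix.PosDef.one.smul hs).add_posSemidef hA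

/-- The Cauchy–Schwarz inequality for the dual pair of norms given by `A` and `A⁻¹`. -/
theorem sq_dotProduct_le_inv_mul {n : Type*} [Fintype n] [DecidableEq n] {A : Matrix n n ℝ}
    (hA : A.PosDef) (c v : n → ℝ) :
    (c ⬝ᵥ v) ^ 2 ≤ (c ⬝ᵥ A⁻¹ *ᵥ c) * (v ⬝ᵥ A *ᵥ v) := by
  have hu : IsUnit A.det := (Matrix.isUnit_iff_isUnit_det _).1 hA.isUnit
  set z := A⁻¹ *ᵥ c with hz
  have hAz : A *ᵥ z = c := by simp [hz, Matrix.mulVec_mulVec, Matrix.mul_nonsing_inv _ hu]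
  have hsymm : z ⬝ᵥ A *ᵥ v = c ⬝ᵥ v := by
    rw [Matrix.dotProduct_mulVec, ← Matrix.mulVec_transpose,
      ← Matrix.conjTranspose_eq_transpose_of_trivial, hA.isHermitian.eq, hAz]
  have key : ∀ t : ℝ, 0 ≤ (c ⬝ᵥ z) * (t * t) + (-2 * (c ⬝ᵥ v)) * t + v ⬝ᵥ A *ᵥ v := by
    intro t
    have h := hA.posSemidef.dotProduct_mulVec_nonneg (v - t • z)
    have e : star (v - t • z) ⬝ᵥ A *ᵥ (v - t • z)
        = (c ⬝ᵥ z) * (t * t) + (-2 * (c ⬝ᵥ v)) * t + v ⬝ᵥ A *ᵥ v := by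
      simp only [star_trivial, Matrix.mulVec_sub, Matrix.mulVec_smul, hAz, sub_dotProduct,
        dotProduct_sub, smul_dotProduct, dotProduct_smul, hsymm, smul_eq_mul]
      rw [dotProduct_comm v c, dotProduct_comm z c]; ring
    rwa [e] at h
  have := discrim_le_zero key
  rw [discrim] at this
  nlinarith

theorem dotProduct_smul_one_add_mulVec {n : Type*} [Fintype n] [DecidableEq n]
    (A : Matrix n n ℝ) (s : ℝ) (v : n → ℝ) :
    v ⬝ᵥ (s • (1 : Matrix n n ℝ) + A) *ᵥ v = s * (v ⬝ᵥ v) + v ⬝ᵥ A *ᵥ v := by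
  simp [Matrix.add_mulVec, Matrix.smul_mulVec]

/-- The quadratic form of the resolvent `(s + A)⁻¹` decreases in `s`. -/
theorem inv_quadForm_antitone {n : Type*} [Fintype n] [DecidableEq n] {A : Matrix n n ℝ}
    (hA : A.PosSemidef) (c : n → ℝ) {s s₀ : ℝ} (hs : 0 < s) (hss : s ≤ s₀) :
    c ⬝ᵥ (s₀ • (1 : Matrix n n ℝ) + A)⁻¹ *ᵥ c ≤ c ⬝ᵥ (s • (1 : Matrix n n ℝ) + A)⁻¹ *ᵥ c := by
  have h₀ := posDef_smul_one_add hA (hs.trans_le hss)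
  have h := posDef_smul_one_add hA hs
  set B := s₀ • (1 : Matrix n n ℝ) + A with hB
  have hu : IsUnit B.det := (Matrix.isUnit_iff_isUnit_det _).1 h₀.isUnit
  set v := B⁻¹ *ᵥ c with hv
  have hBv : B *ᵥ v = c := by simp [hv, Matrix.mulVec_mulVec, Matrix.mul_nonsing_inv _ hu]
  have h1 := sq_dotProduct_le_inv_mul h c v
  have h2 : v ⬝ᵥ (s • (1 : Matrix n n ℝ) + A) *ᵥ v ≤ c ⬝ᵥ v := by
    have hcv : c ⬝ᵥ v = v ⬝ᵥ B *ᵥ v := by rw [hBv, dotProduct_comm]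
    rw [hcv, hB, dotProduct_smul_one_add_mulVec, dotProduct_smul_one_add_mulVec]
    have : 0 ≤ v ⬝ᵥ v := dotProduct_self_star_nonneg v
    nlinarith
  have h3 : 0 ≤ c ⬝ᵥ (s • (1 : Matrix n n ℝ) + A)⁻¹ *ᵥ c := by
    simpa using h.inv.posSemidef.dotProduct_mulVec_nonneg c
  have h4 : 0 ≤ c ⬝ᵥ v := by simpa using h₀.inv.posSemidef.dotProduct_mulVec_nonneg c
  by_contra! hlt
  nlinarith

theorem det_add_smul_vecMulVec {n : Type*} [Fintype n] [DecidableEq n] {A : Matrix n n ℝ}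
    (hA : IsUnit A.det) (c : n → ℝ) (η : ℝ) :
    (A + η • vecMulVec c c).det = A.det * (1 + η * (c ⬝ᵥ A⁻¹ *ᵥ c)) := by
  have h := Matrix.det_add_replicateCol_mul_replicateRow (ι := Unit) hA (η • c) c
  have e : η • vecMulVec c c = replicateCol Unit (η • c) * replicateRow Unit c := by
    rw [← vecMulVec_eq, smul_vecMulVec]
  rw [e, h, Matrix.det_unique (n := Unit)]
  congr 1
  rw [Matrix.mul_assoc, ← Matrix.replicateCol_mulVec, Matrix.add_apply, Matrix.one_apply_eq,
    Matrix.replicateRow_mul_replicateCol_apply, Matrix.mulVec_smul, dotProduct_smul, smul_eq_mul]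

/-! ### The product of the largest eigenvalues -/

theorem det_smul_one_add_eq_prod {d : ℕ} {A : Matrix (Fin d) (Fin d) ℝ} (hA : A.IsHermitian)
    (s : ℝ) : (s • (1 : Matrix (Fin d) (Fin d) ℝ) + A).det = ∏ i, (hA.eigenvalues₀ i + s) := by
  have h1 : A.charpoly.eval (-s) = ∏ i, (-s - hA.eigenvalues₀ i) := by
    rw [hA.charpoly_eq, Polynomial.eval_prod]
    simp only [Polynomial.eval_sub, Polynomial.eval_X, Polynomial.eval_C]
    exact Equiv.prod_comp (Fintype.equivOfCardEq (Fintype.card_fin _)).symm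
      (fun i => -s - hA.eigenvalues₀ i)
  rw [Matrix.eval_charpoly] at h1
  have h2 : (scalar (Fin d)) (-s) - A = -(s • (1 : Matrix (Fin d) (Fin d) ℝ) + A) := by
    ext i j
    by_cases hij : i = j
    · subst hij; simp; ring
    · simp [hij]
  have h3 : ∏ i, (-s - hA.eigenvalues₀ i) = (-1) ^ d * ∏ i, (hA.eigenvalues₀ i + s) := by
    have : ∀ i, -s - hA.eigenvalues₀ i = (-1) * (hA.eigenvalues₀ i + s) := fun i => by ring
    simp only [this, Finset.prod_mul_distrib, Finset.prod_const, Finset.card_univ,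
      Fintype.card_fin]
  rw [h2, h3, Matrix.det_neg] at h1
  simp only [Fintype.card_fin (n := d)] at h1
  exact mul_left_cancel₀ (pow_ne_zero _ (by norm_num)) h1

theorem eigenvalues₀_nonneg {d : ℕ} {A : Matrix (Fin d) (Fin d) ℝ} (hA : A.PosSemidef)
    (i : Fin (Fintype.card (Fin d))) : 0 ≤ hA.isHermitian.eigenvalues₀ i := by
  have := hA.eigenvalues_nonneg (Fintype.equivOfCardEq (Fintype.card_fin _) i)
  simpa [Matrix.IsHermitian.eigenvalues] using this

/-- The eigenvalues of a positive semidefinite matrix of rank at most `k` vanish from the `k`-th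
on, since they are listed in decreasing order. -/
theorem eigenvalues₀_eq_zero_of_rank_le {d k : ℕ} {A : Matrix (Fin d) (Fin d) ℝ}
    (hA : A.PosSemidef) (hk : A.rank ≤ k) (i : Fin (Fintype.card (Fin d))) (hi : k ≤ i.val) :
    hA.isHermitian.eigenvalues₀ i = 0 := by
  by_contra hne
  have hpos : 0 < hA.isHermitian.eigenvalues₀ i :=
    lt_of_le_of_ne (eigenvalues₀_nonneg hA i) (Ne.symm hne)
  have hcard : (Finset.Iic i).card ≤ A.rank := by
    rw [hA.isHermitian.rank_eq_card_non_zero_eigs, Fintype.card_subtype]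
    refine Finset.card_le_card_of_injOn (Fintype.equivOfCardEq (Fintype.card_fin _)) ?_
      (Equiv.injective _).injOn
    intro j hj
    have hj' : j ≤ i := by simpa using hj
    have := hA.isHermitian.eigenvalues₀_antitone hj'
    have hne' := (hpos.trans_le this).ne'
    refine Finset.mem_filter.2 ⟨Finset.mem_univ _, ?_⟩
    simpa [Matrix.IsHermitian.eigenvalues] using hne'
  rw [Fin.card_Iic] at hcard
  omega

/-- For a positive semidefinite matrix of rank at most `k`, the determinant of `s + A` is
`s ^ (d - k)` times the contribution of the `k` largest eigenvalues. -/
theorem det_smul_one_add_of_rank_le {d k : ℕ} (hkd : k ≤ d) {A : Matrix (Fin d) (Fin d) ℝ}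
    (hA : A.PosSemidef) (hk : A.rank ≤ k) (s : ℝ) :
    (s • (1 : Matrix (Fin d) (Fin d) ℝ) + A).det =
      s ^ (d - k) * ∏ i : Fin (Fintype.card (Fin d)) with i.val < k,
        (hA.isHermitian.eigenvalues₀ i + s) := by
  rw [det_smul_one_add_eq_prod hA.isHermitian,
    ← Finset.prod_filter_mul_prod_filter_not Finset.univ
      (fun i : Fin (Fintype.card (Fin d)) => i.val < k), mul_comm]
  congr 1
  rw [Finset.prod_congr rfl (g := fun _ => s)]
  · rw [Finset.prod_const]
    congr 1
    have h1 := Finset.card_filter_add_card_filter_not (s := Finset.univ)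
      (fun i : Fin (Fintype.card (Fin d)) => i.val < k)
    have h2 : (Finset.univ.filter fun i : Fin (Fintype.card (Fin d)) => i.val < k).card = k := by
      rw [Fin.card_filter_val_lt, Fintype.card_fin]; omega
    have h3 : (Finset.univ : Finset (Fin (Fintype.card (Fin d)))).card = d := by
      rw [Finset.card_univ, Fintype.card_fin, Fintype.card_fin]
    exact Nat.eq_sub_of_add_eq' ((congrArg (· + _) h2.symm).trans (h1.trans h3))
  · intro i hi
    rw [eigenvalues₀_eq_zero_of_rank_le hA hk i (by simpa using hi), zero_add]

/-- A rank-one update multiplies the product of the `k` largest eigenvalues by at least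
`1 + η cᵀ (s + A)⁻¹ c`, for every `s > 0`. Both sides are limits of determinants of `t + A` and
its update as `t → 0`, to which the matrix determinant lemma applies. -/
theorem prod_eigenvalues₀_update_ge {d k : ℕ} (hkd : k ≤ d) {A B : Matrix (Fin d) (Fin d) ℝ}
    (hA : A.PosSemidef) (hB : B.PosSemidef) (hAk : A.rank ≤ k) (hBk : B.rank ≤ k)
    (c : Fin d → ℝ) {η : ℝ} (hη : 0 < η) (hη1 : η < 1)
    (hAB : B = (1 - η) • (A + η • vecMulVec c c)) {s : ℝ} (hs : 0 < s) :
    (1 - η) ^ k * (∏ i : Fin (Fintype.card (Fin d)) with i.val < k, hA.isHermitian.eigenvalues₀ i)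
        * (1 + η * (c ⬝ᵥ (s • (1 : Matrix (Fin d) (Fin d) ℝ) + A)⁻¹ *ᵥ c))
      ≤ ∏ i : Fin (Fintype.card (Fin d)) with i.val < k, hB.isHermitian.eigenvalues₀ i := by
  have h1η : 0 < 1 - η := by linarith
  set D : ℝ → ℝ := fun t => c ⬝ᵥ (t • (1 : Matrix (Fin d) (Fin d) ℝ) + A)⁻¹ *ᵥ c
  have hDnn : ∀ t, 0 < t → 0 ≤ D t := fun t ht => by
    simpa using (posDef_smul_one_add hA ht).inv.posSemidef.dotProduct_mulVec_nonneg c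
  set f : ℝ → ℝ := fun t => ∏ i : Fin (Fintype.card (Fin d)) with i.val < k,
    (hB.isHermitian.eigenvalues₀ i + (1 - η) * t)
  have hf : Tendsto f (𝓝[>] 0)
      (𝓝 (∏ i : Fin (Fintype.card (Fin d)) with i.val < k, hB.isHermitian.eigenvalues₀ i)) := by
    have hc : Continuous f := by fun_prop
    have := (hc.tendsto 0).mono_left (nhdsWithin_le_nhds (s := Set.Ioi 0))
    simpa [f] using this
  refine ge_of_tendsto hf ?_
  filter_upwards [Ioo_mem_nhdsGT hs] with t ht
  have hdet : (((1 - η) * t) • (1 : Matrix (Fin d) (Fin d) ℝ) + B).det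
      = (1 - η) ^ d * ((t • (1 : Matrix (Fin d) (Fin d) ℝ) + A).det * (1 + η * D t)) := by
    rw [← det_add_smul_vecMulVec
      ((Matrix.isUnit_iff_isUnit_det _).1 (posDef_smul_one_add hA ht.1).isUnit)]
    have : ((1 - η) * t) • (1 : Matrix (Fin d) (Fin d) ℝ) + B
        = (1 - η) • (t • (1 : Matrix (Fin d) (Fin d) ℝ) + A + η • vecMulVec c c) := by
      rw [hAB, mul_smul, ← smul_add, add_assoc]
    rw [this, Matrix.det_smul, Fintype.card_fin]
  rw [det_smul_one_add_of_rank_le hkd hA hAk, det_smul_one_add_of_rank_le hkd hB hBk] at hdet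
  have hmain : f t = (1 - η) ^ k * (∏ i : Fin (Fintype.card (Fin d)) with i.val < k,
      (hA.isHermitian.eigenvalues₀ i + t)) * (1 + η * D t) := by
    have hne : ((1 - η) * t) ^ (d - k) ≠ 0 := (pow_pos (mul_pos h1η ht.1) _).ne'
    refine mul_left_cancel₀ hne (hdet.trans ?_)
    rw [mul_pow, ← pow_mul_pow_sub (1 - η) hkd]; ring
  rw [hmain]
  have hDt : D s ≤ D t := inv_quadForm_antitone hA c ht.1 ht.2.le
  have hp : (∏ i : Fin (Fintype.card (Fin d)) with i.val < k, hA.isHermitian.eigenvalues₀ i)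
      ≤ ∏ i : Fin (Fintype.card (Fin d)) with i.val < k, (hA.isHermitian.eigenvalues₀ i + t) :=
    Finset.prod_le_prod (fun i _ => eigenvalues₀_nonneg hA i) (fun i _ => by linarith [ht.1])
  have hp0 : 0 ≤ ∏ i : Fin (Fintype.card (Fin d)) with i.val < k,
      hA.isHermitian.eigenvalues₀ i := Finset.prod_nonneg fun i _ => eigenvalues₀_nonneg hA i
  have := hDnn s hs
  have h1 : 0 ≤ 1 + η * D s := by positivity
  have h2 := hp0.trans hp
  change _ * (1 + η * D s) ≤ _
  exact mul_le_mul (mul_le_mul_of_nonneg_left hp (by positivity)) (by gcongr) h1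
    (mul_nonneg (by positivity) h2)

/-! ### Moments of distributions on the unit ball -/

theorem ae_mem_of_support_subset {d : ℕ} {p : PMF (E d)} {S : Set (E d)} (hp : p.support ⊆ S) :
    ∀ᵐ b ∂p.toMeasure, b ∈ S := by
  have h : ∀ᵐ b ∂p.toMeasure, b ∈ p.support := by
    have := (PMF.toMeasure_apply_eq_one_iff p p.support_countable.measurableSet).2 subset_rfl
    rw [ae_iff]
    exact (prob_compl_eq_zero_iff p.support_countable.measurableSet).2 this
  exact h.mono fun b hb => hp hb

theorem integrable_of_support_subset_ball {d : ℕ} {p : PMF (E d)}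
    (hp : p.support ⊆ Metric.closedBall 0 1) {G : Type*} [NormedAddCommGroup G]
    [SecondCountableTopologyEither (E d) G] {g : E d → G} (hg : Continuous g) :
    Integrable g p.toMeasure := by
  obtain ⟨C, hC⟩ := (isCompact_closedBall (0 : E d) 1).exists_bound_of_continuousOn hg.continuousOn
  exact Integrable.of_bound hg.aestronglyMeasurable C
    ((ae_mem_of_support_subset hp).mono hC)

theorem inner_meanAction {d : ℕ} {p : PMF (E d)} (hp : p.support ⊆ Metric.closedBall 0 1)
    (v : E d) : inner ℝ (meanAction p) v = ∫ b, inner ℝ b v ∂p.toMeasure := by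
  have h := integral_inner (𝕜 := ℝ) (integrable_of_support_subset_ball hp continuous_id) v
  simp only [id] at h
  rw [meanAction, real_inner_comm, ← h]
  simp only [real_inner_comm]

theorem meanAction_apply {d : ℕ} {p : PMF (E d)} (hp : p.support ⊆ Metric.closedBall 0 1)
    (i : Fin d) : meanAction p i = ∫ b, b i ∂p.toMeasure := by
  have h := inner_meanAction hp (EuclideanSpace.single i 1)
  simpa [EuclideanSpace.inner_single_right] using h

/-- The quadratic form of the covariance matrix is the variance of the linear functional. -/
theorem covMatrix_quadForm {d : ℕ} {p : PMF (E d)} (hp : p.support ⊆ Metric.closedBall 0 1)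
    (v : E d) : v.ofLp ⬝ᵥ covMatrix p *ᵥ v.ofLp =
      ∫ b, (inner ℝ b v) ^ 2 ∂p.toMeasure - (inner ℝ (meanAction p) v) ^ 2 := by
  have h1 : ∀ b : E d, (inner ℝ b v : ℝ) ^ 2 = ∑ i, ∑ j, v i * v j * (b i * b j) := by
    intro b
    rw [sq, PiLp.inner_apply, Finset.sum_mul_sum]
    refine Finset.sum_congr rfl fun i _ => Finset.sum_congr rfl fun j _ => ?_
    simp; ring
  have h2 : ∫ b, (inner ℝ b v) ^ 2 ∂p.toMeasure
      = ∑ i, ∑ j, v i * v j * ∫ b, b i * b j ∂p.toMeasure := by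
    simp only [h1]
    rw [integral_finsetSum _ fun i _ => integrable_of_support_subset_ball hp (by fun_prop)]
    refine Finset.sum_congr rfl fun i _ => ?_
    rw [integral_finsetSum _ fun j _ => integrable_of_support_subset_ball hp (by fun_prop)]
    refine Finset.sum_congr rfl fun j _ => ?_
    rw [integral_const_mul]
  rw [h2, h1, ← Finset.sum_sub_distrib, dotProduct]
  refine Finset.sum_congr rfl fun i _ => ?_
  rw [mulVec, dotProduct, Finset.mul_sum, ← Finset.sum_sub_distrib]
  refine Finset.sum_congr rfl fun j _ => ?_
  simp only [covMatrix, secondMoment, Matrix.sub_apply, of_apply, vecMulVec_apply]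
  ring

theorem sq_inner_meanAction_le {d : ℕ} {p : PMF (E d)} (hp : p.support ⊆ Metric.closedBall 0 1)
    (v : E d) : (inner ℝ (meanAction p) v) ^ 2 ≤ ∫ b, (inner ℝ b v) ^ 2 ∂p.toMeasure := by
  set c : ℝ := inner ℝ (meanAction p) v with hc
  have h : ∫ b, (inner ℝ b v - c) ^ 2 ∂p.toMeasure
      = ∫ b, (inner ℝ b v) ^ 2 ∂p.toMeasure - c ^ 2 := by
    have e : ∀ b : E d, (inner ℝ b v - c) ^ 2 = (inner ℝ b v) ^ 2 - (2 * c * inner ℝ b v - c ^ 2) :=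
      fun b => by ring
    simp only [e]
    rw [integral_sub (integrable_of_support_subset_ball hp (by fun_prop))
        (integrable_of_support_subset_ball hp (by fun_prop)),
      integral_sub (integrable_of_support_subset_ball hp (by fun_prop)) (integrable_const _),
      integral_const_mul, ← inner_meanAction hp, ← hc]
    simp; ring
  have : 0 ≤ ∫ b, (inner ℝ b v - c) ^ 2 ∂p.toMeasure := integral_nonneg fun b => sq_nonneg _
  linarith

theorem covMatrix_posSemidef {d : ℕ} {p : PMF (E d)} (hp : p.support ⊆ Metric.closedBall 0 1) :
    (covMatrix p).PosSemidef := by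
  refine Matrix.PosSemidef.of_dotProduct_mulVec_nonneg (covMatrix_isHermitian p) fun v => ?_
  have h1 := covMatrix_quadForm hp (WithLp.toLp 2 v)
  have h2 := sq_inner_meanAction_le hp (WithLp.toLp 2 v)
  rw [star_trivial]
  exact h1 ▸ sub_nonneg.2 h2

/-- The covariance matrix annihilates the directions orthogonal to the affine hull of the action
set, along which every linear functional is almost surely constant. -/
theorem covMatrix_rank_le {d : ℕ} {p : PMF (E d)} {S : Set (E d)} (hS : S ⊆ Metric.closedBall 0 1)
    (hp : p.support ⊆ S) : (covMatrix p).rank ≤ affDim S := by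
  have hb := hp.trans hS
  obtain ⟨a₀, ha₀⟩ := p.support_nonempty
  set f : E d →ₗ[ℝ] (Fin d → ℝ) :=
    (covMatrix p).mulVecLin ∘ₗ (WithLp.linearEquiv 2 ℝ (Fin d → ℝ)).toLinearMap with hf
  have hr : (covMatrix p).rank = Module.finrank ℝ (LinearMap.range f) := by
    rw [Matrix.rank, hf, LinearMap.range_comp_of_range_eq_top]
    exact LinearEquiv.range _
  have hker : (vectorSpan ℝ S)ᗮ ≤ LinearMap.ker f := by
    intro v hv
    have hconst : ∀ b ∈ S, (inner ℝ b v : ℝ) = inner ℝ a₀ v := fun b hbS => by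
      have : b -ᵥ a₀ ∈ vectorSpan ℝ S := vsub_mem_vectorSpan ℝ hbS (hp ha₀)
      have h0 := (Submodule.mem_orthogonal _ _).1 hv _ this
      rw [vsub_eq_sub, inner_sub_left] at h0
      linarith
    have hae : ∀ᵐ b ∂p.toMeasure, (inner ℝ b v : ℝ) = inner ℝ a₀ v :=
      (ae_mem_of_support_subset hp).mono hconst
    have hq := covMatrix_quadForm hb v
    rw [inner_meanAction hb, integral_congr_ae hae,
      integral_congr_ae (hae.mono fun b h => by simp only [h] :
        (fun b => (inner ℝ b v : ℝ) ^ 2) =ᵐ[p.toMeasure] fun _ => (inner ℝ a₀ v : ℝ) ^ 2)] at hq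
    have hq0 : star v.ofLp ⬝ᵥ covMatrix p *ᵥ v.ofLp = 0 := by
      rw [star_trivial, hq]; simp
    have := ((covMatrix_posSemidef hb).dotProduct_mulVec_zero_iff v.ofLp).1 hq0
    simpa [hf] using this
  have h1 := LinearMap.finrank_range_add_finrank_ker f
  have h2 := Submodule.finrank_mono hker
  have h3 := Submodule.finrank_add_finrank_orthogonal (vectorSpan ℝ S)
  rw [hr, affDim]
  omega

theorem affDim_le {d : ℕ} (S : Set (E d)) : affDim S ≤ d := by
  have := Submodule.finrank_le (vectorSpan ℝ S)
  rwa [finrank_euclideanSpace_fin] at this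

/-- The mixture `(1 - η) p + η δ_a`. -/
noncomputable def mixDirac {d : ℕ} (p : PMF (E d)) (a : E d) (η : ℝ≥0) (hη : η ≤ 1) : PMF (E d) :=
  ⟨fun b => (1 - η : ℝ≥0) * p b + η * PMF.pure a b, by
    rw [ENNReal.summable.hasSum_iff, ENNReal.tsum_add, ENNReal.tsum_mul_left, ENNReal.tsum_mul_left,
      PMF.tsum_coe, PMF.tsum_coe, mul_one, mul_one]
    exact_mod_cast tsub_add_cancel_of_le hη⟩

theorem mixDirac_apply {d : ℕ} (p : PMF (E d)) (a : E d) {η : ℝ≥0} (hη : η ≤ 1) (b : E d) :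
    mixDirac p a η hη b = (1 - η : ℝ≥0) * p b + η * PMF.pure a b := rfl

theorem mixDirac_support_subset {d : ℕ} {p : PMF (E d)} {a : E d} {S : Set (E d)} {η : ℝ≥0}
    (hη : η ≤ 1) (hp : p.support ⊆ S) (ha : a ∈ S) : (mixDirac p a η hη).support ⊆ S := by
  intro b hb
  by_cases hba : b = a
  · exact hba ▸ ha
  · refine hp fun h0 => hb ?_
    rw [mixDirac_apply, h0, PMF.pure_apply_of_ne _ _ hba]
    simp

theorem mixDirac_toMeasure {d : ℕ} (p : PMF (E d)) (a : E d) {η : ℝ≥0} (hη : η ≤ 1) :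
    (mixDirac p a η hη).toMeasure =
      (1 - η) • p.toMeasure + η • Measure.dirac a := by
  ext s hs
  rw [← PMF.toMeasure_pure, Measure.add_apply, Measure.smul_apply, Measure.smul_apply,
    PMF.toMeasure_apply _ hs, PMF.toMeasure_apply _ hs, PMF.toMeasure_apply _ hs,
    ENNReal.smul_def, ENNReal.smul_def, smul_eq_mul, smul_eq_mul, ← ENNReal.tsum_mul_left,
    ← ENNReal.tsum_mul_left, ← ENNReal.tsum_add]
  refine tsum_congr fun b => ?_
  by_cases hb : b ∈ s
  · simp only [Set.indicator_of_mem hb, mixDirac_apply]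
  · simp only [Set.indicator_of_notMem hb, mul_zero, add_zero]

theorem integral_mixDirac {d : ℕ} {p : PMF (E d)} (hp : p.support ⊆ Metric.closedBall 0 1)
    (a : E d) {η : ℝ≥0} (hη : η ≤ 1) {g : E d → ℝ} (hg : Continuous g) :
    ∫ b, g b ∂(mixDirac p a η hη).toMeasure =
      (1 - (η : ℝ)) * ∫ b, g b ∂p.toMeasure + η * g a := by
  rw [mixDirac_toMeasure, integral_add_measure, integral_smul_nnreal_measure,
    integral_smul_nnreal_measure, integral_dirac, NNReal.smul_def, NNReal.smul_def,
    NNReal.coe_sub hη]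
  · rfl
  · exact (integrable_of_support_subset_ball hp hg).smul_measure_nnreal
  · exact (integrable_dirac (by simp)).smul_measure_nnreal

theorem covMatrix_mixDirac {d : ℕ} {p : PMF (E d)} (hp : p.support ⊆ Metric.closedBall 0 1)
    {a : E d} (ha : a ∈ Metric.closedBall (0 : E d) 1) {η : ℝ≥0} (hη : η ≤ 1) :
    covMatrix (mixDirac p a η hη) = (1 - (η : ℝ)) •
      (covMatrix p + (η : ℝ) • vecMulVec (a - meanAction p).ofLp (a - meanAction p).ofLp) := by
  have hq := mixDirac_support_subset hη hp ha
  ext i j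
  have e1 : ∀ i, meanAction (mixDirac p a η hη) i = (1 - (η : ℝ)) * meanAction p i + η * a i :=
    fun i => by
      rw [meanAction_apply hq, meanAction_apply hp]
      exact integral_mixDirac hp a hη (by fun_prop)
  have e2 : ∫ b, b i * b j ∂(mixDirac p a η hη).toMeasure
      = (1 - (η : ℝ)) * ∫ b, b i * b j ∂p.toMeasure + η * (a i * a j) :=
    integral_mixDirac hp a hη (by fun_prop)
  simp only [covMatrix, secondMoment, Matrix.sub_apply, of_apply, vecMulVec_apply, Matrix.add_apply,
    Matrix.smul_apply, smul_eq_mul, PiLp.sub_apply, e1, e2]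
  ring

/-! ### First-order optimality for the log-determinant barrier -/

/-- First-order optimality: comparing the minimizer with its mixtures with `δ_a` bounds the
quadratic form of `(s + Σ)⁻¹` at `a - ā`. -/
theorem IsLogdetBarrier.inv_quadForm_le {d : ℕ} {θ : E d} {γ : ℝ} {S : Set (E d)} {p : PMF (E d)}
    (h : IsLogdetBarrier θ γ S p) (hγ : 0 < γ) (hS : S ⊆ Metric.closedBall 0 1) {a : E d}
    (ha : a ∈ S) {s : ℝ} (hs : 0 < s) :
    (a - meanAction p).ofLp ⬝ᵥ (s • (1 : Matrix (Fin d) (Fin d) ℝ) + covMatrix p)⁻¹ *ᵥ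
        (a - meanAction p).ofLp
      ≤ γ * inner ℝ (a - meanAction p) θ + affDim S := by
  obtain ⟨hp, hdet, hmin⟩ := h
  have hb := hp.trans hS
  set k := affDim S
  set c := a - meanAction p with hc
  set D := c.ofLp ⬝ᵥ (s • (1 : Matrix (Fin d) (Fin d) ℝ) + covMatrix p)⁻¹ *ᵥ c.ofLp with hD
  have hpsd := covMatrix_posSemidef hb
  have hD0 : 0 ≤ D := by
    simpa using (posDef_smul_one_add hpsd hs).inv.posSemidef.dotProduct_mulVec_nonneg c.ofLp
  have key : ∀ η : ℝ, 0 < η → η < 1 →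
      D / (1 + η * D) - k / (1 - η) ≤ γ * inner ℝ c θ := by
    intro η hη hη1
    lift η to ℝ≥0 using hη.le
    have hη1' : η ≤ 1 := by exact_mod_cast hη1.le
    have h1η : 0 < 1 - (η : ℝ) := by linarith
    have hq := mixDirac_support_subset hη1' hp ha
    have hupd : (1 - (η : ℝ)) ^ k * covDet S p * (1 + η * D) ≤ covDet S (mixDirac p a η hη1') :=
      prod_eigenvalues₀_update_ge (affDim_le S) hpsd (covMatrix_posSemidef (hq.trans hS))
        (covMatrix_rank_le hS hp) (covMatrix_rank_le hS hq) c.ofLp hη hη1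
        (covMatrix_mixDirac hb (hS ha) hη1') hs
    have h1D : 0 < 1 + η * D := by positivity
    have hpos : 0 < (1 - (η : ℝ)) ^ k * covDet S p * (1 + η * D) := by positivity
    have hm := hmin _ hq (hpos.trans_le hupd)
    have hlog := Real.log_le_log hpos hupd
    rw [Real.log_mul (by positivity) h1D.ne', Real.log_mul (by positivity) hdet.ne',
      Real.log_pow] at hlog
    have hmean : (inner ℝ (meanAction (mixDirac p a η hη1')) θ : ℝ)
        = inner ℝ (meanAction p) θ + η * inner ℝ c θ := by
      rw [inner_meanAction (hq.trans hS), integral_mixDirac hb a hη1' (by fun_prop),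
        ← inner_meanAction hb, hc, inner_sub_left]
      ring
    rw [logdetObjective, logdetObjective, hmean] at hm
    have hm2 : Real.log (covDet S (mixDirac p a η hη1')) - Real.log (covDet S p)
        ≤ γ * (η * inner ℝ c θ) := by
      have : γ⁻¹ * (Real.log (covDet S (mixDirac p a η hη1')) - Real.log (covDet S p))
        ≤ η * inner ℝ c θ := by linarith
      rwa [inv_mul_le_iff₀ hγ] at this
    have l1 : -(η / (1 - η)) ≤ Real.log (1 - (η : ℝ)) := by
      have := Real.one_sub_inv_le_log_of_pos h1η
      have e : 1 - (1 - (η : ℝ))⁻¹ = -(η / (1 - η)) := by field_simp; ring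
      linarith
    have l2 : η * D / (1 + η * D) ≤ Real.log (1 + η * D) := by
      have := Real.one_sub_inv_le_log_of_pos h1D
      have e : 1 - (1 + η * D)⁻¹ = η * D / (1 + η * D) := by field_simp; ring
      linarith
    have l3 : (k : ℝ) * -(η / (1 - η)) ≤ k * Real.log (1 - (η : ℝ)) := by gcongr
    have : η * (D / (1 + η * D) - k / (1 - η)) ≤ η * (γ * inner ℝ c θ) := by
      have e : η * (D / (1 + η * D) - k / (1 - η))
        = k * -(η / (1 - η)) + η * D / (1 + η * D) := by ring
      rw [e]; linarith
    exact le_of_mul_le_mul_left this hη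
  have hlim : Tendsto (fun η : ℝ => D / (1 + η * D) - k / (1 - η)) (𝓝[>] 0) (𝓝 (D - k)) := by
    have hc : ContinuousAt (fun η : ℝ => D / (1 + η * D) - k / (1 - η)) 0 := by
      apply ContinuousAt.sub <;> apply ContinuousAt.div <;> first | fun_prop | simp
    have := hc.tendsto.mono_left (nhdsWithin_le_nhds (s := Set.Ioi 0))
    simpa using this
  have := le_of_tendsto hlim (by
    filter_upwards [Ioo_mem_nhdsGT (zero_lt_one (α := ℝ))] with η hη using key η hη.1 hη.2)
  linarith

/-- The per-round guarantee of the log-determinant barrier: the regret of its solution with respect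
to any parameter `θ'` is at most `d / γ` plus `γ / 4` times the expected squared difference of the
predictions of `θ` and `θ'`. -/
theorem IsLogdetBarrier.inner_sub_le {d : ℕ} {θ : E d} {γ : ℝ} {S : Set (E d)} {p : PMF (E d)}
    (h : IsLogdetBarrier θ γ S p) (hγ : 0 < γ) (hS : S ⊆ Metric.closedBall 0 1) (θ' : E d) {a : E d}
    (ha : a ∈ S) :
    inner ℝ (meanAction p) θ' - inner ℝ a θ' ≤
      d / γ + γ / 4 * ∫ b, (inner ℝ b (θ - θ')) ^ 2 ∂p.toMeasure := by
  have hb := h.1.trans hS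
  set v := θ - θ' with hv
  set c := a - meanAction p with hc
  set I := ∫ b, (inner ℝ b v) ^ 2 ∂p.toMeasure
  have hk : (affDim S : ℝ) ≤ d := by exact_mod_cast affDim_le S
  have key : ∀ s : ℝ, 0 < s →
      inner ℝ (meanAction p) θ' - inner ℝ a θ' ≤ d / γ + γ / 4 * (s * (v.ofLp ⬝ᵥ v.ofLp) + I) := by
    intro s hs
    have h1 := h.inv_quadForm_le hγ hS ha hs
    have hpd := posDef_smul_one_add (covMatrix_posSemidef hb) hs
    have h2 := sq_dotProduct_le_inv_mul hpd c.ofLp v.ofLp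
    rw [dotProduct_smul_one_add_mulVec, covMatrix_quadForm hb] at h2
    set D := c.ofLp ⬝ᵥ (s • (1 : Matrix (Fin d) (Fin d) ℝ) + covMatrix p)⁻¹ *ᵥ c.ofLp
    have hD0 : 0 ≤ D := by simpa using hpd.inv.posSemidef.dotProduct_mulVec_nonneg c.ofLp
    set W := s * (v.ofLp ⬝ᵥ v.ofLp) + I with hW
    have hcv : c.ofLp ⬝ᵥ v.ofLp = inner ℝ c v := by
      simp [PiLp.inner_apply, dotProduct, mul_comm]
    have h3 : (inner ℝ c v : ℝ) ^ 2 ≤ D * W := by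
      rw [← hcv]
      refine h2.trans (mul_le_mul_of_nonneg_left ?_ hD0)
      have := sq_nonneg (inner ℝ (meanAction p) v : ℝ)
      linarith
    have e : (inner ℝ (meanAction p) θ' - inner ℝ a θ' : ℝ) = inner ℝ c v - inner ℝ c θ := by
      rw [hv, hc]; simp only [inner_sub_left, inner_sub_right]; ring
    -- `⟨c, v⟩ ≤ √(D W) ≤ D / γ + γ W / 4`, while optimality gives `D / γ ≤ ⟨c, θ⟩ + d / γ`.
    have hW0 : 0 ≤ W := by
      have h0 : 0 ≤ v.ofLp ⬝ᵥ v.ofLp := dotProduct_self_star_nonneg v.ofLp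
      have hI : 0 ≤ I := integral_nonneg fun b => sq_nonneg _
      positivity
    have h4 : (inner ℝ c v : ℝ) ≤ D / γ + γ / 4 * W := by
      refine le_trans (Real.le_sqrt_of_sq_le h3) ?_
      rw [Real.sqrt_le_left (by positivity)]
      have : D * W = D / γ * (γ * W) := by field_simp
      nlinarith [sq_nonneg (D / γ - γ / 4 * W)]
    have h5 : D / γ ≤ inner ℝ c θ + d / γ := by
      rw [div_le_iff₀ hγ, add_mul, div_mul_cancel₀ _ hγ.ne']
      linarith
    rw [e]; linarith
  have hlim : Tendsto (fun s : ℝ => d / γ + γ / 4 * (s * (v.ofLp ⬝ᵥ v.ofLp) + I)) (𝓝[>] 0)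
      (𝓝 (d / γ + γ / 4 * I)) := by
    have hc : Continuous (fun s : ℝ => d / γ + γ / 4 * (s * (v.ofLp ⬝ᵥ v.ofLp) + I)) := by fun_prop
    have := (hc.tendsto 0).mono_left (nhdsWithin_le_nhds (s := Set.Ioi 0))
    simpa using this
  exact ge_of_tendsto hlim (by filter_upwards [self_mem_nhdsWithin] with s hs using key s hs)

end CorralCB

namespace CorralCB

/-! ### Conditional laws and Lebesgue integrals -/

/-- A conditional law with values in a standard Borel space agrees almost surely with the regular
conditional distribution, so that it is almost surely given by a kernel. -/
theorem HasCondLaw.ae_eq_condDistrib {Ω α β : Type*} [MeasurableSpace Ω] [MeasurableSpace α]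
    [MeasurableSpace β] [StandardBorelSpace β] [Nonempty β] {P : Measure Ω} [IsProbabilityMeasure P]
    {Z : Ω → α} (hZ : Measurable Z) {X : Ω → β} (hX : Measurable X) {κ : Ω → Measure β}
    (hκ : ∀ ω, IsProbabilityMeasure (κ ω))
    (h : HasCondLaw P (MeasurableSpace.comap Z inferInstance) X κ) :
    ∀ᵐ ω ∂P, κ ω = condDistrib X Z P (Z ω) := by
  have hset : ∀ s : Set β, MeasurableSet s → ∀ᵐ ω ∂P, κ ω s = condDistrib X Z P (Z ω) s := by
    intro s hs
    have hm : Measurable (s.indicator (fun _ => (1 : ℝ))) := measurable_const.indicator hs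
    have hb : ∀ b, |s.indicator (fun _ => (1 : ℝ)) b| ≤ 1 := fun b => by
      by_cases hb : b ∈ s <;> simp [hb]
    have h1 := h _ hm ⟨1, hb⟩
    have h2 := condExp_ae_eq_integral_condDistrib (μ := P) hZ hX.aemeasurable hm.stronglyMeasurable
      (Integrable.of_bound (hm.comp hX).aestronglyMeasurable 1
        (Filter.Eventually.of_forall fun ω => hb (X ω)))
    filter_upwards [h1, h2] with ω e1 e2
    have e := e1.symm.trans e2
    have := hκ ω
    rw [integral_indicator_const _ hs, integral_indicator_const _ hs] at e
    simp only [smul_eq_mul, mul_one] at e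
    exact (measureReal_eq_measureReal_iff).1 e
  have hall : ∀ᵐ ω ∂P, ∀ a b : ℚ, κ ω (embeddingReal β ⁻¹' Set.Ioo (a : ℝ) b)
      = condDistrib X Z P (Z ω) (embeddingReal β ⁻¹' Set.Ioo (a : ℝ) b) :=
    ae_all_iff.2 fun a => ae_all_iff.2 fun b =>
      hset _ ((measurableEmbedding_embeddingReal β).measurable measurableSet_Ioo)
  filter_upwards [hall] with ω hω
  have := hκ ω
  have he := measurableEmbedding_embeddingReal β
  have : (κ ω).map (embeddingReal β) = (condDistrib X Z P (Z ω)).map (embeddingReal β) := by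
    have := Measure.isProbabilityMeasure_map (μ := κ ω) he.measurable.aemeasurable
    refine Real.measure_ext_Ioo_rat fun a b => ?_
    rw [he.map_apply, he.map_apply, hω]
  rw [← he.comap_map (κ ω), this, he.comap_map]

theorem HasCondLaw.lintegral_eq_of_comap {Ω α β : Type*} [MeasurableSpace Ω] [MeasurableSpace α]
    [MeasurableSpace β] [StandardBorelSpace β] [Nonempty β] {P : Measure Ω} [IsProbabilityMeasure P]
    {Z : Ω → α} (hZ : Measurable Z) {X : Ω → β} (hX : Measurable X) {κ : Ω → Measure β}
    (hκ : ∀ ω, IsProbabilityMeasure (κ ω))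
    (h : HasCondLaw P (MeasurableSpace.comap Z inferInstance) X κ)
    {g : α × β → ℝ≥0∞} (hg : Measurable g) :
    ∫⁻ ω, g (Z ω, X ω) ∂P = ∫⁻ ω, ∫⁻ b, g (Z ω, b) ∂κ ω ∂P := by
  rw [← lintegral_map hg (hZ.prodMk hX), ← compProd_map_condDistrib hX.aemeasurable,
    Measure.lintegral_compProd hg, lintegral_map hg.lintegral_kernel_prod_right' hZ]
  refine lintegral_congr_ae ?_
  filter_upwards [HasCondLaw.ae_eq_condDistrib hZ hX hκ h] with ω hω
  rw [hω]

/-- Disintegration along a conditional law: a nonnegative function of the past and of `X` is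
integrated by first integrating out `X`. -/
theorem HasCondLaw.lintegral_eq {Ω β : Type*} {𝒢 : MeasurableSpace Ω}
    [mΩ : MeasurableSpace Ω] [mβ : MeasurableSpace β] [StandardBorelSpace β]
    [Nonempty β] {P : Measure Ω} [IsProbabilityMeasure P] (h𝒢 : 𝒢 ≤ mΩ)
    {X : Ω → β} (hX : Measurable X) {κ : Ω → Measure β}
    (hκ : ∀ ω, IsProbabilityMeasure (κ ω)) (h : HasCondLaw P 𝒢 X κ)
    {g : Ω × β → ℝ≥0∞} (hg : Measurable[𝒢.prod mβ] g) :
    ∫⁻ ω, g (ω, X ω) ∂P = ∫⁻ ω, ∫⁻ b, g (ω, b) ∂κ ω ∂P := by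
  have hid : @Measurable Ω Ω mΩ 𝒢 id := measurable_id'' h𝒢
  have hc : HasCondLaw P (@MeasurableSpace.comap Ω Ω id 𝒢) X κ := by
    rwa [MeasurableSpace.comap_id]
  exact @HasCondLaw.lintegral_eq_of_comap Ω Ω β mΩ 𝒢 mβ _ _ P _ id hid X hX κ hκ hc g hg

/-- The same for events: the indicator of `s` may be replaced by its conditional probability `q`. -/
theorem lintegral_indicator_of_condProb {Ω : Type*} {𝒢 : MeasurableSpace Ω}
    [mΩ : MeasurableSpace Ω] {P : Measure Ω} [IsProbabilityMeasure P]
    (h𝒢 : 𝒢 ≤ mΩ) {s : Set Ω}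
    (hs : MeasurableSet s) {q : Ω → ℝ} (hq : Measurable[𝒢] q) (hq0 : ∀ ω, 0 ≤ q ω)
    (h : P⟦s | 𝒢⟧ =ᵐ[P] q) {Z : Ω → ℝ≥0∞} (hZ : Measurable[𝒢] Z) :
    ∫⁻ ω, s.indicator Z ω ∂P = ∫⁻ ω, ENNReal.ofReal (q ω) * Z ω ∂P := by
  have hint : Integrable (s.indicator (fun _ => (1 : ℝ))) P :=
    (integrable_const (1 : ℝ)).indicator hs
  have hqint : Integrable q P := integrable_condExp.congr h
  have hqm : Measurable q := hq.mono h𝒢 le_rfl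
  refine @Measurable.ennreal_induction Ω 𝒢
    (fun Z => ∫⁻ ω, s.indicator Z ω ∂P = ∫⁻ ω, ENNReal.ofReal (q ω) * Z ω ∂P) ?_ ?_ ?_ Z hZ
  · intro c t ht
    have ht' := h𝒢 t ht
    have h1 : ∫ ω in t, q ω ∂P = P.real (s ∩ t) := by
      rw [← setIntegral_congr_ae (f := P⟦s | 𝒢⟧) ht' (h.mono fun ω hω _ => hω),
        setIntegral_condExp h𝒢 hint ht, integral_indicator_const _ hs, smul_eq_mul, mul_one,
        measureReal_restrict_apply hs]
    have h2 : ∫⁻ ω in t, ENNReal.ofReal (q ω) ∂P = P (s ∩ t) := by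
      rw [← ofReal_integral_eq_lintegral_ofReal hqint.integrableOn
        (Filter.Eventually.of_forall hq0), h1, ofReal_measureReal]
    have e1 : ∀ ω, s.indicator (t.indicator fun _ => c) ω = (s ∩ t).indicator (fun _ => c) ω := by
      intro ω; rw [Set.indicator_indicator]
    have e2 : ∀ ω, ENNReal.ofReal (q ω) * t.indicator (fun _ => c) ω
        = c * t.indicator (fun ω => ENNReal.ofReal (q ω)) ω := by
      intro ω; by_cases hω : ω ∈ t <;> simp [hω, mul_comm]
    simp only [e1, e2]
    rw [lintegral_indicator_const (hs.inter ht'), lintegral_const_mul _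
      (hqm.ennreal_ofReal.indicator ht'), lintegral_indicator ht', h2]
  · intro f g _ hf hg h1 h2
    have hf' := hf.mono h𝒢 le_rfl
    have e1 : ∀ ω, s.indicator (f + g) ω = s.indicator f ω + s.indicator g ω := fun ω => by
      rw [Set.indicator_add']; rfl
    have hqf : Measurable fun ω => ENNReal.ofReal (q ω) * f ω := hqm.ennreal_ofReal.mul hf'
    simp only [e1, Pi.add_apply, mul_add]
    rw [lintegral_add_left (hf'.indicator hs), lintegral_add_left hqf, h1, h2]
  · intro f hf hmono ih
    have hf' := fun n => (hf n).mono h𝒢 le_rfl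
    have e1 : ∀ ω, s.indicator (fun x => ⨆ n, f n x) ω = ⨆ n, s.indicator (f n) ω := fun ω => by
      by_cases hω : ω ∈ s <;> simp [hω]
    have hqf : ∀ n, Measurable fun ω => ENNReal.ofReal (q ω) * f n ω :=
      fun n => hqm.ennreal_ofReal.mul (hf' n)
    simp only [e1, ENNReal.mul_iSup]
    rw [lintegral_iSup (fun n => (hf' n).indicator hs), lintegral_iSup hqf]
    · exact iSup_congr ih
    · exact fun i j hij ω => mul_le_mul_right (hmono hij ω) _
    · exact fun i j hij ω => Set.indicator_le_indicator (hmono hij ω)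

/-! ### Completing a partial run of the oracle -/

section Completion

variable {𝒳 : Type*} {d T : ℕ}

/-- What the oracle knows when it makes its `n`-th prediction. -/
def pastCtx (n : Fin T) (r : Fin T → Record 𝒳 d) : (Fin n → Record 𝒳 d) × (𝒳 × ℝ) :=
  (fun i : Fin n => r (Fin.castLE n.isLt.le i), (r n).1)

@[fun_prop]
theorem measurable_pastCtx [MeasurableSpace 𝒳] (n : Fin T) :
    Measurable (pastCtx (𝒳 := 𝒳) (d := d) n) := by
  unfold pastCtx; fun_prop

/-- On the event `B`, the `n`-th prediction is drawn from the kernel of the oracle. -/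
def WeightedOracle.PredLawOn [MeasurableSpace 𝒳] (orc : WeightedOracle 𝒳 d)
    (Q : Measure (Fin T → Record 𝒳 d)) (n : Fin T) (B : Set (Fin T → Record 𝒳 d)) : Prop :=
  ∀ g : ((Fin n → Record 𝒳 d) × (𝒳 × ℝ)) × E d → ℝ≥0∞, Measurable g →
    ∫⁻ r, B.indicator (fun r => g (pastCtx n r, (r n).2.1)) r ∂Q =
      ∫⁻ r, B.indicator (fun r => ∫⁻ y, g (pastCtx n r, y) ∂orc.kernel n (pastCtx n r)) r ∂Q

/-- The event that round `n` carries a nonzero weight. The rounds of zero weight have no influence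
on the weighted losses, so they serve to fill up a run of fewer than `T` rounds. -/
def live (n : Fin T) : Set (Fin T → Record 𝒳 d) := {r | (r n).1.2 ≠ 0}

theorem measurableSet_live [MeasurableSpace 𝒳] (n : Fin T) :
    MeasurableSet (live (𝒳 := 𝒳) (d := d) n) := by
  have : Measurable fun r : Fin T → Record 𝒳 d => (r n).1.2 := by fun_prop
  exact this (measurableSet_singleton 0).compl

/-- Two records are equivalent if they differ at most in the predictions of rounds of zero
weight. -/
def SameLive (r r' : Fin T → Record 𝒳 d) : Prop :=
  ∀ n, (r n).1 = (r' n).1 ∧ (r n).2.2 = (r' n).2.2 ∧ ((r n).1.2 ≠ 0 → r n = r' n)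

open Classical in
/-- Replace the prediction of round `k` by `y` if that round has zero weight. -/
noncomputable def resample (k : Fin T) (z : (Fin T → Record 𝒳 d) × E d) : Fin T → Record 𝒳 d :=
  if (z.1 k).1.2 = 0 then Function.update z.1 k ((z.1 k).1, (z.2, (z.1 k).2.2)) else z.1

theorem measurable_resample [MeasurableSpace 𝒳] (k : Fin T) :
    Measurable (resample (𝒳 := 𝒳) (d := d) k) := by
  unfold resample
  have h0 : Measurable fun z : (Fin T → Record 𝒳 d) × E d => (z.1 k).1.2 := by fun_prop
  refine Measurable.ite (h0 (measurableSet_singleton 0)) ?_ measurable_fst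
  refine measurable_pi_iff.2 fun i => ?_
  by_cases hi : i = k
  · subst hi; simp only [Function.update_self]; fun_prop
  · simp only [Function.update_of_ne hi]; fun_prop

theorem resample_of_live {k : Fin T} {r : Fin T → Record 𝒳 d} (h : r ∈ live k) (y : E d) :
    resample k (r, y) = r := if_neg h

theorem resample_of_notMem_live {k : Fin T} {r : Fin T → Record 𝒳 d} (h : r ∉ live k) (y : E d) :
    resample k (r, y) = Function.update r k ((r k).1, (y, (r k).2.2)) := if_pos (not_not.1 h)

theorem resample_apply_of_ne {k i : Fin T} (hi : i ≠ k) (r : Fin T → Record 𝒳 d) (y : E d) :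
    resample k (r, y) i = r i := by
  by_cases h : r ∈ live k
  · rw [resample_of_live h]
  · rw [resample_of_notMem_live h, Function.update_of_ne hi]

theorem resample_apply_fst (k i : Fin T) (r : Fin T → Record 𝒳 d) (y : E d) :
    (resample k (r, y) i).1 = (r i).1 := by
  by_cases hi : i = k
  · subst hi
    by_cases h : r ∈ live i
    · rw [resample_of_live h]
    · rw [resample_of_notMem_live h, Function.update_self]
  · rw [resample_apply_of_ne hi]

theorem sameLive_resample (k : Fin T) (r : Fin T → Record 𝒳 d) (y : E d) :
    SameLive (resample k (r, y)) r := by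
  intro i
  refine ⟨resample_apply_fst k i r y, ?_, fun hi => ?_⟩
  · by_cases hi : i = k
    · subst hi
      by_cases h : r ∈ live i
      · rw [resample_of_live h]
      · rw [resample_of_notMem_live h, Function.update_self]
    · rw [resample_apply_of_ne hi]
  · rw [resample_apply_fst] at hi
    by_cases hik : i = k
    · subst hik; rw [resample_of_live hi]
    · rw [resample_apply_of_ne hik]

theorem pastCtx_resample {k n : Fin T} (hn : n ≤ k) (r : Fin T → Record 𝒳 d) (y : E d) :
    pastCtx n (resample k (r, y)) = pastCtx n r := by
  refine Prod.ext (funext fun i => ?_) (resample_apply_fst k n r y)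
  refine resample_apply_of_ne (fun h => ?_) r y
  have h1 : (i : ℕ) = k := congrArg Fin.val h
  have h2 : (i : ℕ) < n := i.isLt
  have h3 : (n : ℕ) ≤ k := hn
  omega

theorem sameLive_mem_live_iff {r r' : Fin T → Record 𝒳 d} (h : SameLive r r') (n : Fin T) :
    r ∈ live n ↔ r' ∈ live n := by
  have e : (r n).1.2 = (r' n).1.2 := congrArg Prod.snd (h n).1
  change (r n).1.2 ≠ 0 ↔ (r' n).1.2 ≠ 0
  rw [e]

/-- An almost sure property which ignores the predictions of zero weight passes to laws with the
same integrals of functions which ignore them. -/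
theorem ae_of_forall_lintegral_le [MeasurableSpace 𝒳] {Q Q₀ : Measure (Fin T → Record 𝒳 d)}
    (h : ∀ G : (Fin T → Record 𝒳 d) → ℝ≥0∞, (∀ r r', SameLive r r' → G r = G r') →
      ∫⁻ r, G r ∂Q ≤ ∫⁻ r, G r ∂Q₀)
    {D : (Fin T → Record 𝒳 d) → Prop} (hD : MeasurableSet {r | D r})
    (hinv : ∀ r r', SameLive r r' → (D r ↔ D r')) (hae : ∀ᵐ r ∂Q₀, D r) : ∀ᵐ r ∂Q, D r := by
  have hz := h ({r | D r}ᶜ.indicator 1) (by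
    intro r r' hrr
    by_cases hr : D r
    · rw [Set.indicator_of_notMem (not_not.2 hr),
        Set.indicator_of_notMem (not_not.2 ((hinv r r' hrr).1 hr))]
    · rw [Set.indicator_of_mem (show r ∈ {r | D r}ᶜ from hr),
        Set.indicator_of_mem (show r' ∈ {r | D r}ᶜ from mt (hinv r r' hrr).2 hr)]
      rfl)
  rw [lintegral_indicator_one hD.compl, lintegral_indicator_one hD.compl] at hz
  exact le_antisymm (hz.trans (ae_iff.1 hae).le) bot_le

/-- The law of the record after the prediction of round `k` has been redrawn from the kernel of the
oracle, if that round has zero weight. -/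
noncomputable def WeightedOracle.redraw [MeasurableSpace 𝒳] (orc : WeightedOracle 𝒳 d)
    (Q : Measure (Fin T → Record 𝒳 d)) (k : Fin T) : Measure (Fin T → Record 𝒳 d) :=
  (Q ⊗ₘ (orc.kernel k).comap (pastCtx k) (measurable_pastCtx k)).map (resample k)

variable [MeasurableSpace 𝒳] (orc : WeightedOracle 𝒳 d) (Q : Measure (Fin T → Record 𝒳 d))
  [IsProbabilityMeasure Q] (k : Fin T)

instance : IsProbabilityMeasure (orc.redraw Q k) := by
  have := orc.isMarkov k
  exact Measure.isProbabilityMeasure_map (measurable_resample k).aemeasurable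

theorem WeightedOracle.lintegral_redraw {G : (Fin T → Record 𝒳 d) → ℝ≥0∞} (hG : Measurable G) :
    ∫⁻ r, G r ∂orc.redraw Q k =
      ∫⁻ r, ∫⁻ y, G (resample k (r, y)) ∂orc.kernel k (pastCtx k r) ∂Q := by
  have := orc.isMarkov k
  rw [redraw, lintegral_map hG (measurable_resample k),
    Measure.lintegral_compProd (f := fun z => G (resample k z)) (hG.comp (measurable_resample k))]
  rfl

theorem WeightedOracle.lintegral_redraw_of_ae_eq {G : (Fin T → Record 𝒳 d) → ℝ≥0∞}
    (hG : Measurable G) (h : ∀ᵐ r ∂Q, ∀ y, G (resample k (r, y)) = G r) :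
    ∫⁻ r, G r ∂orc.redraw Q k = ∫⁻ r, G r ∂Q := by
  have := orc.isMarkov k
  rw [orc.lintegral_redraw Q k hG]
  refine lintegral_congr_ae ?_
  filter_upwards [h] with r hr
  simp [hr]

/-- Redrawing predictions does not increase the upper integral of a function which ignores them.
This covers infima over a class of functions, which need not be measurable. -/
theorem WeightedOracle.lintegral_redraw_le {G : (Fin T → Record 𝒳 d) → ℝ≥0∞}
    (h : ∀ r r', SameLive r r' → G r = G r') :
    ∫⁻ r, G r ∂orc.redraw Q k ≤ ∫⁻ r, G r ∂Q := by
  have := orc.isMarkov k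
  obtain ⟨g, hg, hgG, e⟩ := exists_measurable_le_lintegral_eq (orc.redraw Q k) G
  rw [e, orc.lintegral_redraw Q k hg]
  refine lintegral_mono fun r => ?_
  calc ∫⁻ y, g (resample k (r, y)) ∂orc.kernel k (pastCtx k r)
      ≤ ∫⁻ _, G r ∂orc.kernel k (pastCtx k r) :=
        lintegral_mono fun y => (hgG _).trans (h _ _ (sameLive_resample k r y)).le
    _ = G r := by simp

theorem WeightedOracle.measurable_lintegral_kernel (n : Fin T)
    {g : ((Fin n → Record 𝒳 d) × (𝒳 × ℝ)) × E d → ℝ≥0∞} (hg : Measurable g) :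
    Measurable fun r : Fin T → Record 𝒳 d =>
      ∫⁻ y, g (pastCtx n r, y) ∂orc.kernel n (pastCtx n r) := by
  have := orc.isMarkov n
  exact (hg.lintegral_kernel_prod_right' (κ := orc.kernel n)).comp (measurable_pastCtx n)

variable {Q} in
theorem WeightedOracle.PredLawOn.redraw_of_lt {n : Fin T} (hn : n < k)
    (h : orc.PredLawOn Q n Set.univ) : orc.PredLawOn (orc.redraw Q k) n Set.univ := by
  intro g hg
  have h1 := h g hg
  simp only [Set.indicator_univ] at h1 ⊢
  rw [orc.lintegral_redraw_of_ae_eq, orc.lintegral_redraw_of_ae_eq, h1]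
  · exact orc.measurable_lintegral_kernel n hg
  · exact .of_forall fun r y => by rw [pastCtx_resample hn.le]
  · fun_prop
  · exact .of_forall fun r y => by rw [pastCtx_resample hn.le, resample_apply_of_ne hn.ne]

variable {Q} in
theorem WeightedOracle.PredLawOn.redraw_live {n : Fin T} (hmono : ∀ᵐ r ∂Q, k ≤ n →
    r ∈ live n → r ∈ live k) (h : orc.PredLawOn Q n (live n)) :
    orc.PredLawOn (orc.redraw Q k) n (live n) := by
  intro g hg
  have hlive : ∀ (r : Fin T → Record 𝒳 d) (y : E d), resample k (r, y) ∈ live n ↔ r ∈ live n :=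
    fun r y => sameLive_mem_live_iff (sameLive_resample k r y) n
  rw [orc.lintegral_redraw_of_ae_eq, orc.lintegral_redraw_of_ae_eq, h g hg]
  · exact (orc.measurable_lintegral_kernel n hg).indicator (measurableSet_live n)
  · filter_upwards [hmono] with r hr y
    by_cases hl : r ∈ live n
    · rw [Set.indicator_of_mem ((hlive r y).2 hl), Set.indicator_of_mem hl]
      rcases lt_or_ge n k with hnk | hnk
      · rw [pastCtx_resample hnk.le]
      · rw [resample_of_live (hr hnk hl)]
    · rw [Set.indicator_of_notMem (mt (hlive r y).1 hl), Set.indicator_of_notMem hl]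
  · have : Measurable fun r : Fin T → Record 𝒳 d => g (pastCtx n r, (r n).2.1) := by fun_prop
    exact this.indicator (measurableSet_live n)
  · filter_upwards [hmono] with r hr y
    by_cases hl : r ∈ live n
    · rw [Set.indicator_of_mem ((hlive r y).2 hl), Set.indicator_of_mem hl]
      rcases lt_or_ge n k with hnk | hnk
      · rw [pastCtx_resample hnk.le, resample_apply_of_ne hnk.ne]
      · rw [resample_of_live (hr hnk hl)]
    · rw [Set.indicator_of_notMem (mt (hlive r y).1 hl), Set.indicator_of_notMem hl]

variable {Q} in
theorem WeightedOracle.PredLawOn.redraw_self (h : orc.PredLawOn Q k (live k)) :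
    orc.PredLawOn (orc.redraw Q k) k Set.univ := by
  have := orc.isMarkov k
  intro g hg
  simp only [Set.indicator_univ]
  set G₂ : (Fin T → Record 𝒳 d) → ℝ≥0∞ := fun r =>
    ∫⁻ y, g (pastCtx k r, y) ∂orc.kernel k (pastCtx k r) with hG₂
  have hG₂m : Measurable G₂ := orc.measurable_lintegral_kernel k hg
  set G₁ : (Fin T → Record 𝒳 d) → ℝ≥0∞ := fun r => g (pastCtx k r, (r k).2.1) with hG₁
  have hG₁m : Measurable G₁ := by fun_prop
  rw [orc.lintegral_redraw_of_ae_eq Q k hG₂m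
    (.of_forall fun r y => by simp only [hG₂, pastCtx_resample le_rfl]),
    orc.lintegral_redraw Q k hG₁m]
  have hinner : ∀ r, ∫⁻ y, G₁ (resample k (r, y)) ∂orc.kernel k (pastCtx k r)
      = (live k).indicator G₁ r + (live k)ᶜ.indicator G₂ r := by
    intro r
    by_cases hr : r ∈ live k
    · simp [hr, resample_of_live hr]
    · simp only [Set.indicator_of_notMem hr, Set.indicator_of_mem (Set.mem_compl hr), zero_add, hG₂,
        hG₁, pastCtx_resample le_rfl]
      refine lintegral_congr fun y => ?_
      rw [resample_of_notMem_live hr, Function.update_self]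
  simp only [hinner]
  have hl := measurableSet_live (𝒳 := 𝒳) (d := d) k
  rw [lintegral_add_left (hG₁m.indicator hl), h g hg,
    ← lintegral_add_left (hG₂m.indicator hl)]
  refine lintegral_congr fun r => ?_
  exact congrFun (Set.indicator_self_add_compl (live k) G₂) r

/-- A partial run, in which the predictions of the rounds of nonzero weight follow the oracle and
these rounds come first, can be completed to a full run by redrawing the other predictions one
after the other. -/
theorem WeightedOracle.exists_completion {Q₀ : Measure (Fin T → Record 𝒳 d)}
    [IsProbabilityMeasure Q₀] (h : ∀ n, orc.PredLawOn Q₀ n (live n))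
    (hmono : ∀ᵐ r ∂Q₀, ∀ k n : Fin T, k ≤ n → r ∈ live n → r ∈ live k) :
    ∃ Q : Measure (Fin T → Record 𝒳 d), IsProbabilityMeasure Q ∧
      (∀ n, orc.PredLawOn Q n Set.univ) ∧
      (∀ G : (Fin T → Record 𝒳 d) → ℝ≥0∞, (∀ r r', SameLive r r' → G r = G r') →
        ∫⁻ r, G r ∂Q ≤ ∫⁻ r, G r ∂Q₀) ∧
      ∀ G : (Fin T → Record 𝒳 d) → ℝ≥0∞, Measurable G → (∀ r r', SameLive r r' → G r = G r') →
        ∫⁻ r, G r ∂Q = ∫⁻ r, G r ∂Q₀ := by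
  have main : ∀ j ≤ T, ∃ Q : Measure (Fin T → Record 𝒳 d), IsProbabilityMeasure Q ∧
      (∀ n : Fin T, n.val < j → orc.PredLawOn Q n Set.univ) ∧
      (∀ n, orc.PredLawOn Q n (live n)) ∧
      (∀ᵐ r ∂Q, ∀ k n : Fin T, k ≤ n → r ∈ live n → r ∈ live k) ∧
      (∀ G : (Fin T → Record 𝒳 d) → ℝ≥0∞, (∀ r r', SameLive r r' → G r = G r') →
        ∫⁻ r, G r ∂Q ≤ ∫⁻ r, G r ∂Q₀) ∧
      ∀ G : (Fin T → Record 𝒳 d) → ℝ≥0∞, Measurable G → (∀ r r', SameLive r r' → G r = G r') →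
        ∫⁻ r, G r ∂Q = ∫⁻ r, G r ∂Q₀ := by
    intro j
    induction j with
    | zero => exact fun _ => ⟨Q₀, inferInstance, by simp, h, hmono, fun _ _ => le_rfl,
        fun _ _ _ => rfl⟩
    | succ j ih =>
      intro hj
      obtain ⟨Q, hQ, h1, h2, h3, h4, h5⟩ := ih (by omega)
      set k : Fin T := ⟨j, hj⟩
      refine ⟨orc.redraw Q k, inferInstance, fun n hn => ?_, fun n => ?_, ?_, fun G hG => ?_,
        fun G hGm hG => ?_⟩
      · rcases lt_or_eq_of_le (Nat.lt_succ_iff.1 hn) with hlt | heq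
        · exact WeightedOracle.PredLawOn.redraw_of_lt orc k (Fin.lt_def.2 hlt) (h1 n hlt)
        · have hnk : n = k := Fin.ext heq
          rw [hnk]
          exact WeightedOracle.PredLawOn.redraw_self orc k (h2 k)
      · exact WeightedOracle.PredLawOn.redraw_live orc k (h3.mono fun r hr => hr k n) (h2 n)
      · have hms : MeasurableSet {r : Fin T → Record 𝒳 d |
            ∀ k n : Fin T, k ≤ n → r ∈ live n → r ∈ live k} := by
          have : {r : Fin T → Record 𝒳 d | ∀ k n : Fin T, k ≤ n → r ∈ live n → r ∈ live k}
              = ⋂ (k : Fin T) (n : Fin T) (_ : k ≤ n), (live n)ᶜ ∪ live k := by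
            ext r; simp [imp_iff_not_or]
          rw [this]
          exact MeasurableSet.iInter fun k => MeasurableSet.iInter fun n => MeasurableSet.iInter
            fun _ => (measurableSet_live n).compl.union (measurableSet_live k)
        refine ae_of_forall_lintegral_le (fun G hG => orc.lintegral_redraw_le Q k hG) hms
          (fun r r' hrr => ?_) h3
        simp only [sameLive_mem_live_iff hrr]
      · exact (orc.lintegral_redraw_le Q k hG).trans (h4 G hG)
      · rw [orc.lintegral_redraw_of_ae_eq Q k hGm
          (.of_forall fun r y => hG _ _ (sameLive_resample k r y)), h5 G hGm hG]
  obtain ⟨Q, hQ, h1, -, -, h4, h5⟩ := main T le_rfl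
  exact ⟨Q, hQ, fun n => h1 n n.isLt, h4, h5⟩

/-- The regret bound of the oracle applies to partial runs: after a completion, the redrawn
predictions do not matter, since they are made in rounds of zero weight. -/
theorem WeightedOracle.HasRegret.of_partial_run {orc : WeightedOracle 𝒳 d} {F : Set (𝒳 → E d)}
    {R : ℝ≥0} (horc : orc.HasRegret F T R) {Q₀ : Measure (Fin T → Record 𝒳 d)}
    [IsProbabilityMeasure Q₀] (h : ∀ n, orc.PredLawOn Q₀ n (live n))
    (hmono : ∀ᵐ r ∂Q₀, ∀ k n : Fin T, k ≤ n → r ∈ live n → r ∈ live k)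
    (hw : ∀ᵐ r ∂Q₀, ∀ n, 0 ≤ (r n).1.2)
    (ha : ∀ᵐ r ∂Q₀, ∀ n, (r n).2.2.1 ∈ Metric.closedBall (0 : E d) 1)
    (hl : ∀ᵐ r ∂Q₀, ∀ n, (r n).2.2.2 ∈ Set.Icc (-1 : ℝ) 1) {f : 𝒳 → E d} (hf : f ∈ F) :
    ∫⁻ r, ENNReal.ofReal
        (∑ n, (r n).1.2 * (inner ℝ (r n).2.2.1 (r n).2.1 - (r n).2.2.2) ^ 2) ∂Q₀
      ≤ ∫⁻ r, ENNReal.ofReal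
          (∑ n, (r n).1.2 * (inner ℝ (r n).2.2.1 (f (r n).1.1) - (r n).2.2.2) ^ 2) ∂Q₀
        + (∫⁻ r, ⨆ n, ENNReal.ofReal (r n).1.2 ∂Q₀) * R := by
  obtain ⟨Q, hQ, h1, h2, h3⟩ := orc.exists_completion h hmono
  have htransfer : ∀ p : (𝒳 × ℝ) → (E d × ℝ) → Prop,
      MeasurableSet {z : (𝒳 × ℝ) × (E d × ℝ) | p z.1 z.2} →
      (∀ᵐ r ∂Q₀, ∀ n, p (r n).1 (r n).2.2) → ∀ᵐ r ∂Q, ∀ n, p (r n).1 (r n).2.2 := by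
    intro p hp hae
    have hms : MeasurableSet {r : Fin T → Record 𝒳 d | ∀ n, p (r n).1 (r n).2.2} := by
      have : {r : Fin T → Record 𝒳 d | ∀ n, p (r n).1 (r n).2.2}
          = ⋂ n : Fin T, (fun r : Fin T → Record 𝒳 d => ((r n).1, (r n).2.2)) ⁻¹'
            {z : (𝒳 × ℝ) × (E d × ℝ) | p z.1 z.2} := by
        ext r; simp
      rw [this]
      exact MeasurableSet.iInter fun n => (by fun_prop : Measurable
        (fun r : Fin T → Record 𝒳 d => ((r n).1, (r n).2.2))) hp
    refine ae_of_forall_lintegral_le h2 hms (fun r r' hrr => ?_) hae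
    simp only [fun n => (hrr n).1, fun n => (hrr n).2.1]
  have hwQ : ∀ᵐ r ∂Q, ∀ n, 0 ≤ (r n).1.2 := htransfer (fun u _ => 0 ≤ u.2)
    (measurableSet_le measurable_const (by fun_prop)) hw
  have hrun : orc.IsRun T Q :=
    { isProb := hQ
      pred_law := fun n => by
        have := orc.isMarkov n
        refine Measure.ext_of_lintegral _ fun g hg => ?_
        rw [Measure.lintegral_compProd hg, lintegral_map hg (by fun_prop),
          lintegral_map hg.lintegral_kernel_prod_right' (by fun_prop)]
        have h1' := h1 n g hg
        simp only [Set.indicator_univ] at h1'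
        exact h1'
      weight_nonneg := hwQ
      action_mem := htransfer (fun _ v => v.1 ∈ Metric.closedBall (0 : E d) 1)
        ((by fun_prop : Measurable fun z : (𝒳 × ℝ) × (E d × ℝ) => z.2.1)
          Metric.isClosed_closedBall.measurableSet) ha
      loss_mem := htransfer (fun _ v => v.2 ∈ Set.Icc (-1 : ℝ) 1)
        ((by fun_prop : Measurable fun z : (𝒳 × ℝ) × (E d × ℝ) => z.2.2) measurableSet_Icc) hl }
  have hreg := horc Q hrun
  have hloss : ∀ n, ∀ r r' : Fin T → Record 𝒳 d, SameLive r r' →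
      (r n).1.2 * (inner ℝ (r n).2.2.1 (r n).2.1 - (r n).2.2.2) ^ 2
        = (r' n).1.2 * (inner ℝ (r' n).2.2.1 (r' n).2.1 - (r' n).2.2.2) ^ 2 := by
    intro n r r' hrr
    obtain ⟨e1, e2, e3⟩ := hrr n
    by_cases h0 : (r n).1.2 = 0
    · rw [h0, ← e1, h0, zero_mul, zero_mul]
    · rw [e3 h0]
  rw [h3 _ (by fun_prop) (fun r r' hrr => by simp only [fun n => hloss n r r' hrr])] at hreg
  refine hreg.trans (add_le_add ?_ (mul_le_mul_left ?_ _))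
  · refine le_trans (lintegral_mono_ae ?_) (h2 _ fun r r' hrr => by
      simp only [fun n => (hrr n).1, fun n => (hrr n).2.1])
    filter_upwards [hwQ] with r hr
    refine ENNReal.ofReal_le_ofReal (ciInf_le ⟨0, ?_⟩ (⟨f, hf⟩ : F))
    rintro _ ⟨f', rfl⟩
    exact Finset.sum_nonneg fun n _ => mul_nonneg (hr n) (sq_nonneg _)
  · exact h2 _ fun r r' hrr => by simp only [fun n => (hrr n).1]

end Completion

/-! ### The rounds in which a base algorithm is selected -/

theorem exists_lt_of_lt_count {p : ℕ → Prop} [DecidablePred p] {n t : ℕ} (h : n < Nat.count p t) :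
    ∃ j < t, p j ∧ Nat.count p j = n := by
  induction t with
  | zero => simp at h
  | succ t ih =>
    by_cases hn : n < Nat.count p t
    · obtain ⟨j, hj, h'⟩ := ih hn
      exact ⟨j, by omega, h'⟩
    · rw [Nat.count_succ] at h
      by_cases hp : p t
      · rw [if_pos hp] at h
        exact ⟨t, by omega, hp, by omega⟩
      · rw [if_neg hp] at h; omega

theorem sum_range_count_nth {β : Type*} [AddCommMonoid β] (p : ℕ → Prop) [DecidablePred p]
    (φ : ℕ → β) (t : ℕ) :
    ∑ n ∈ Finset.range (Nat.count p t), φ (Nat.nth p n)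
      = ∑ s ∈ Finset.range t, if p s then φ s else 0 := by
  induction t with
  | zero => simp
  | succ t ih =>
    rw [Finset.sum_range_succ _ t, Nat.count_succ, ← ih]
    by_cases hp : p t
    · rw [if_pos hp, if_pos hp, Finset.sum_range_succ, Nat.nth_count hp]
    · rw [if_neg hp, if_neg hp]; simp

section Measurability

variable {Ω β : Type*} [MeasurableSpace Ω] [MeasurableSpace β] {M : ℕ}

theorem measurable_count {A : ℕ → Ω → Fin M} (m : Fin M) {t : ℕ} (hA : ∀ s < t, Measurable (A s)) :
    Measurable fun ω => Nat.count (fun s => A s ω = m) t := by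
  induction t with
  | zero => simp
  | succ t ih =>
    simp only [Nat.count_succ]
    exact (ih fun s hs => hA s (by omega)).add (Measurable.ite
      (hA t (by omega) (measurableSet_singleton m)) measurable_const measurable_const)

/-- The value of a process in the `n`-th round before `t` in which `m` is selected is measurable
with respect to what determines the selections and the process before `t`. -/
theorem measurable_ite_nth {A : ℕ → Ω → Fin M} (m : Fin M) {f : ℕ → Ω → β} (b : β) {t : ℕ}
    (hA : ∀ s < t, Measurable (A s)) (hf : ∀ s < t, Measurable (f s)) (n : ℕ) :
    Measurable fun ω => if n < Nat.count (fun s => A s ω = m) t then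
      f (Nat.nth (fun s => A s ω = m) n) ω else b := by
  set σ : Ω → ℕ := fun ω => if n < Nat.count (fun s => A s ω = m) t then
    Nat.nth (fun s => A s ω = m) n else t with hσ
  have hc := measurable_count m hA
  have hσm : Measurable σ := by
    refine measurable_to_countable' fun j => ?_
    rcases lt_trichotomy j t with hj | hj | hj
    · have : σ ⁻¹' {j} = A j ⁻¹' {m} ∩ (fun ω => Nat.count (fun s => A s ω = m) j) ⁻¹' {n} := by
        ext ω
        simp only [hσ, Set.mem_preimage, Set.mem_singleton_iff, Set.mem_inter_iff]
        constructor
        · intro h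
          split_ifs at h with hn
          · obtain ⟨i, -, hi, hi'⟩ := exists_lt_of_lt_count hn
            rw [← hi', Nat.nth_count hi] at h
            subst h; exact ⟨hi, hi'⟩
          · omega
        · rintro ⟨h1, h2⟩
          rw [if_pos (h2 ▸ Nat.count_strict_mono (p := fun s => A s ω = m) h1 hj), ← h2]
          exact Nat.nth_count (p := fun s => A s ω = m) h1
      rw [this]
      exact (hA j hj (measurableSet_singleton m)).inter
        (measurable_count m (fun s hs => hA s (hs.trans hj)) (measurableSet_singleton n))
    · have : σ ⁻¹' {j} = (fun ω => Nat.count (fun s => A s ω = m) t) ⁻¹' {c | c ≤ n} := by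
        ext ω
        simp only [hσ, Set.mem_preimage, Set.mem_singleton_iff]
        change _ ↔ Nat.count (fun s => A s ω = m) t ≤ n
        split_ifs with hn
        · have := Nat.nth_lt_of_lt_count hn
          omega
        · omega
      rw [this]
      exact hc (Set.to_countable _).measurableSet
    · have : σ ⁻¹' {j} = ∅ := by
        ext ω
        simp only [hσ, Set.mem_preimage, Set.mem_singleton_iff, Set.mem_empty_iff_false, iff_false]
        split_ifs with hn
        · have := Nat.nth_lt_of_lt_count hn
          omega
        · omega
      rw [this]; exact MeasurableSet.empty
  have hF : Measurable fun z : Ω × ℕ => if z.2 < t then f z.2 z.1 else b := by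
    refine measurable_from_prod_countable_left fun j => ?_
    by_cases hj : j < t
    · simpa [hj] using hf j hj
    · simp [hj]
  have h := hF.comp (measurable_id.prodMk hσm)
  refine (congrArg Measurable (funext fun ω => ?_)).mp h
  simp only [Function.comp, hσ, id]
  by_cases hn : n < Nat.count (fun s => A s ω = m) t
  · simp only [if_pos hn, if_pos (Nat.nth_lt_of_lt_count hn)]
  · simp only [if_neg hn, lt_irrefl, if_false]

theorem measurable_one_div_inf'_range {f : ℕ → Ω → ℝ} {t : ℕ} (hf : ∀ s ≤ t, Measurable (f s)) :
    Measurable fun ω =>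
      1 / (Finset.range (t + 1)).inf' Finset.nonempty_range_add_one (fun s => f s ω) := by
  have h : Measurable ((Finset.range (t + 1)).inf' Finset.nonempty_range_add_one f) :=
    Finset.inf'_induction Finset.nonempty_range_add_one _ (p := fun g : Ω → ℝ => Measurable g)
      (fun f hf g hg => Measurable.inf hf hg)
      fun s hs => hf s (by have := Finset.mem_range.1 hs; omega)
  have h' := h.const_div 1
  simpa only [Finset.inf'_apply] using h'

end Measurability

/-! ### Measurability and bounds for the parameters of the scheme -/

section Scheme

variable {𝒳 Ω : Type*} [MeasurableSpace 𝒳] [mΩ : MeasurableSpace Ω] {d M T : ℕ}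
  {S : Scheme Ω d M} {P : Measure Ω} {orc : WeightedOracle 𝒳 d} {R : ℝ≥0}
  {μ : E d → 𝒳 → ℝ} {x : ℕ → 𝒳} {𝒜 : ℕ → Set (E d)}

namespace Scheme

theorem ℱ_le_afterSelect (S : Scheme Ω d M) (t : ℕ) : S.ℱ t ≤ S.afterSelect t := le_sup_left

theorem afterSelect_le_afterPred (S : Scheme Ω d M) (t : ℕ) : S.afterSelect t ≤ S.afterPred t :=
  le_sup_left

theorem afterPred_le_afterAct (S : Scheme Ω d M) (t : ℕ) : S.afterPred t ≤ S.afterAct t :=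
  le_sup_left

theorem afterAct_le_afterLoss (S : Scheme Ω d M) (t : ℕ) : S.afterAct t ≤ S.afterLoss t :=
  le_sup_left

theorem measurable_A_afterSelect (S : Scheme Ω d M) (t : ℕ) :
    Measurable[S.afterSelect t] (S.A t) :=
  Measurable.of_comap_le le_sup_right

theorem measurable_pred_afterPred (S : Scheme Ω d M) (t : ℕ) :
    Measurable[S.afterPred t] (S.pred t) :=
  Measurable.of_comap_le le_sup_right

theorem measurable_act_afterAct (S : Scheme Ω d M) (t : ℕ) :
    Measurable[S.afterAct t] (S.act t) :=
  Measurable.of_comap_le le_sup_right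

theorem measurable_loss_afterLoss (S : Scheme Ω d M) (t : ℕ) :
    Measurable[S.afterLoss t] (S.loss t) :=
  Measurable.of_comap_le le_sup_right

namespace IsRun

variable (hS : S.IsRun P orc T R μ x 𝒜)
include hS

theorem afterLoss_le {s t : ℕ} (hst : s < t) (hs : s < T) : S.afterLoss s ≤ S.ℱ t :=
  (hS.history s hs).trans (S.ℱ.mono hst)

theorem afterLoss_le_top {t : ℕ} (ht : t < T) : S.afterLoss t ≤ mΩ :=
  (hS.history t ht).trans (S.ℱ.le _)

theorem afterAct_le {t : ℕ} (ht : t < T) : S.afterAct t ≤ mΩ :=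
  (S.afterAct_le_afterLoss t).trans (hS.afterLoss_le_top ht)

theorem afterPred_le {t : ℕ} (ht : t < T) : S.afterPred t ≤ mΩ :=
  (S.afterPred_le_afterAct t).trans (hS.afterAct_le ht)

theorem afterSelect_le {t : ℕ} (ht : t < T) : S.afterSelect t ≤ mΩ :=
  (S.afterSelect_le_afterPred t).trans (hS.afterPred_le ht)

theorem measurable_q {s t : ℕ} (hst : s ≤ t) (ht : t < T) (m : Fin M) :
    Measurable[S.ℱ t] fun ω => S.q s ω m :=
  (hS.q_measurable s (hst.trans_lt ht) m).mono (S.ℱ.mono hst) le_rfl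

theorem inf_q_pos {t : ℕ} (ht : t < T) (ω : Ω) (m : Fin M) :
    0 < (Finset.range (t + 1)).inf' Finset.nonempty_range_add_one (fun s => S.q s ω m) := by
  rw [Finset.lt_inf'_iff]
  intro s hs
  exact hS.q_pos s (by have := Finset.mem_range.1 hs; omega) ω m

theorem rho_pos {t : ℕ} (ht : t < T) (m : Fin M) (ω : Ω) : 0 < S.rho t m ω :=
  one_div_pos.2 (hS.inf_q_pos ht ω m)

theorem inv_q_le_rho {t : ℕ} (ht : t < T) (m : Fin M) (ω : Ω) :
    (S.q t ω m)⁻¹ ≤ S.rho t m ω := by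
  rw [rho, one_div]
  exact inv_anti₀ (hS.inf_q_pos ht ω m) (Finset.inf'_le _ (by simp))

theorem rho_mono {s t : ℕ} (hst : s ≤ t) (ht : t < T) (m : Fin M) (ω : Ω) :
    S.rho s m ω ≤ S.rho t m ω := by
  rw [rho, rho]
  refine one_div_le_one_div_of_le (hS.inf_q_pos ht ω m) (Finset.inf'_mono _ ?_ _)
  exact Finset.range_subset_range.2 (by omega)

theorem measurable_rho {t : ℕ} (ht : t < T) (m : Fin M) : Measurable[S.ℱ t] (S.rho t m) :=
  @measurable_one_div_inf'_range Ω (S.ℱ t) (fun s ω => S.q s ω m) t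
    fun _ hs => hS.measurable_q hs ht m

theorem measurable_gamma {t : ℕ} (ht : t < T) (m : Fin M) :
    Measurable[S.ℱ t] (S.gamma T R t m) := by
  have h := hS.measurable_rho ht m
  let := S.ℱ t
  unfold gamma
  by_cases hR : R = 0
  · simp only [if_pos hR]; exact measurable_const
  · simp only [if_neg hR]; fun_prop

theorem measurable_weight {t : ℕ} (ht : t < T) (m : Fin M) :
    Measurable[S.ℱ t] (S.weight T R t m) := by
  have h := hS.measurable_gamma ht m
  have h' := hS.measurable_q le_rfl ht m
  let := S.ℱ t
  unfold weight
  exact Measurable.div h h'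

omit hS in
theorem _root_.CorralCB.Scheme.gamma_le (S : Scheme Ω d M) (T : ℕ) (R : ℝ≥0) (t : ℕ) (m : Fin M)
    (ω : Ω) : S.gamma T R t m ω ≤ √d / gridEps m := by
  unfold gamma
  split_ifs
  · exact le_rfl
  · exact min_le_left _ _

omit hS in
theorem _root_.CorralCB.gridEps_pos (m : Fin M) : 0 < gridEps m := Real.exp_pos _

theorem gamma_pos (hd : 0 < d) {t : ℕ} (ht : t < T) (m : Fin M) (ω : Ω) :
    0 < S.gamma T R t m ω := by
  have hd' : (0 : ℝ) < d := by exact_mod_cast hd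
  have hT : (0 : ℝ) < T := by exact_mod_cast (by omega : 0 < T)
  have h1 : 0 < √(d : ℝ) / gridEps m := div_pos (Real.sqrt_pos.2 hd') (gridEps_pos m)
  unfold gamma
  split_ifs with hR
  · exact h1
  · have hR' : (0 : ℝ) < R := by exact_mod_cast pos_iff_ne_zero.2 hR
    exact lt_min h1 (Real.sqrt_pos.2 (div_pos (by positivity) (mul_pos (hS.rho_pos ht m ω) hR')))

theorem weight_pos (hd : 0 < d) {t : ℕ} (ht : t < T) (m : Fin M) (ω : Ω) :
    0 < S.weight T R t m ω :=
  div_pos (hS.gamma_pos hd ht m ω) (hS.q_pos t ht ω m)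

/-- The choice of the learning rate makes `max w · Reg_Sq` at most `√(d T ρ Reg_Sq)`. -/
theorem weight_mul_le {t : ℕ} (ht : t < T) (m : Fin M) (ω : Ω) :
    S.weight T R t m ω * R ≤ √(d * T * R) * √(S.rho (T - 1) m ω) := by
  by_cases hR : R = 0
  · simp [hR]
  have hR' : (0 : ℝ) < R := by exact_mod_cast pos_iff_ne_zero.2 hR
  have hρ := hS.rho_pos ht m ω
  have h1 : S.gamma T R t m ω ≤ √(d * T / (S.rho t m ω * R)) := by
    unfold gamma; rw [if_neg hR]; exact min_le_right _ _
  have h2 : S.weight T R t m ω * R ≤ √(d * T / (S.rho t m ω * R)) * S.rho t m ω * R := by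
    unfold weight
    rw [div_eq_mul_inv]
    gcongr
    · exact (inv_pos.2 (hS.q_pos t ht ω m)).le
    · exact hS.inv_q_le_rho ht m ω
  have h3 : √(d * T / (S.rho t m ω * R)) * S.rho t m ω * R = √(d * T * R) * √(S.rho t m ω) := by
    rw [← Real.sqrt_mul (by positivity), mul_assoc,
      ← Real.sqrt_sq (by positivity : 0 ≤ S.rho t m ω * R), ← Real.sqrt_mul (by positivity),
      Real.sqrt_sq (by positivity : 0 ≤ S.rho t m ω * R)]
    congr 1
    field_simp
  rw [h3] at h2
  refine h2.trans ?_
  gcongr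
  exact hS.rho_mono (by omega) (by omega) m ω

theorem div_gamma_le {t : ℕ} (ht : t < T) (m : Fin M) (ω : Ω) :
    d / S.gamma T R t m ω ≤ gridEps m * √d + √(d * R / T) * √(S.rho (T - 1) m ω) := by
  rcases Nat.eq_zero_or_pos d with rfl | hd
  · simp
  have hd' : (0 : ℝ) < d := by exact_mod_cast hd
  have hT : (0 : ℝ) < T := by exact_mod_cast (by omega : 0 < T)
  have he := gridEps_pos m
  have hρ := hS.rho_pos ht m ω
  have e1 : (d : ℝ) / (√d / gridEps m) = gridEps m * √d := by
    have := Real.mul_self_sqrt hd'.le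
    have := Real.sqrt_pos.2 hd'
    field_simp; nlinarith
  have hnn : 0 ≤ √(d * R / T) * √(S.rho (T - 1) m ω) := by positivity
  unfold gamma
  split_ifs with hR
  · rw [e1]; linarith
  · have hR' : (0 : ℝ) < R := by exact_mod_cast pos_iff_ne_zero.2 hR
    rcases min_choice (√d / gridEps m) √(d * T / (S.rho t m ω * R)) with h | h <;> rw [h]
    · rw [e1]; linarith
    · have e2 : (d : ℝ) / √(d * T / (S.rho t m ω * R)) = √(d * R / T) * √(S.rho t m ω) := by
        have hpos : 0 < (d : ℝ) * T / (S.rho t m ω * R) := by positivity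
        rw [div_eq_iff (Real.sqrt_pos.2 hpos).ne', ← Real.sqrt_mul (by positivity),
          ← Real.sqrt_mul (by positivity)]
        have : (d : ℝ) * R / T * S.rho t m ω * (d * T / (S.rho t m ω * R)) = d ^ 2 := by
          field_simp
        rw [this, Real.sqrt_sq hd'.le]
      rw [e2]
      have h3 : √(d * R / T) * √(S.rho t m ω) ≤ √(d * R / T) * √(S.rho (T - 1) m ω) := by
        gcongr
        exact hS.rho_mono (by omega) (by omega) m ω
      have : 0 ≤ gridEps m * √(d : ℝ) := by positivity
      linarith

end IsRun

end Scheme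

end Scheme

/-! ### The run of the oracle of a base algorithm inside the scheme -/

namespace Scheme

section

variable {𝒳 Ω : Type*} [MeasurableSpace Ω] {d M : ℕ}

/-- The record of round `t` for the oracle of base algorithm `m`; it is `S.record` in the rounds in
which `m` is selected. -/
noncomputable def recordOf (S : Scheme Ω d M) (T : ℕ) (R : ℝ≥0) (x : ℕ → 𝒳) (m : Fin M) (t : ℕ)
    (ω : Ω) : Record 𝒳 d :=
  ((x t, S.weight T R t m ω), (S.pred t ω, (S.act t ω, S.loss t ω)))

/-- The `n`-th round of the oracle of base algorithm `m`, among those before round `t` of the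
scheme; if there are at most `n` of these, a blank record of zero weight. -/
noncomputable def partialRun (S : Scheme Ω d M) (T : ℕ) (R : ℝ≥0) (x : ℕ → 𝒳) (m : Fin M) (t n : ℕ)
    (ω : Ω) : Record 𝒳 d :=
  if n < Nat.count (fun s => S.A s ω = m) t then
    S.recordOf T R x m (Nat.nth (fun s => S.A s ω = m) n) ω else ((x 0, 0), (0, (0, 0)))

theorem partialRun_of_lt_count (S : Scheme Ω d M) (T : ℕ) (R : ℝ≥0) (x : ℕ → 𝒳) {m : Fin M}
    {t u n : ℕ} (htu : t ≤ u) {ω : Ω} (hn : n < Nat.count (fun s => S.A s ω = m) t) :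
    S.partialRun T R x m u n ω = S.partialRun T R x m t n ω := by
  have h := hn.trans_le (Nat.count_monotone (fun s => S.A s ω = m) htu)
  rw [partialRun, partialRun, if_pos hn, if_pos h]

theorem partialRun_count (S : Scheme Ω d M) (T : ℕ) (R : ℝ≥0) (x : ℕ → 𝒳) {m : Fin M}
    {t u : ℕ} (htu : t < u) {ω : Ω} (ht : S.A t ω = m) :
    S.partialRun T R x m u (Nat.count (fun s => S.A s ω = m) t) ω = S.recordOf T R x m t ω := by
  rw [partialRun, if_pos (Nat.count_strict_mono (p := fun s => S.A s ω = m) ht htu),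
    Nat.nth_count (p := fun s => S.A s ω = m) ht]

theorem partialRun_of_count_le (S : Scheme Ω d M) (T : ℕ) (R : ℝ≥0) (x : ℕ → 𝒳) {m : Fin M}
    {t n : ℕ} {ω : Ω} (hn : Nat.count (fun s => S.A s ω = m) t ≤ n) :
    S.partialRun T R x m t n ω = ((x 0, 0), (0, (0, 0))) := if_neg hn.not_gt

theorem predLaw_eq [MeasurableSpace 𝒳] (S : Scheme Ω d M) (orc : WeightedOracle 𝒳 d) (T : ℕ)
    (R : ℝ≥0) (x : ℕ → 𝒳) {m : Fin M} {t n : ℕ} {ω : Ω} (ht : S.A t ω = m)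
    (hn : Nat.count (fun s => S.A s ω = m) t = n) :
    S.predLaw orc T R x t (S.A t ω) ω = orc.kernel n
      (fun i => S.partialRun T R x m t i ω, (x t, S.weight T R t m ω)) := by
  subst hn
  rw [ht, predLaw]
  congr 2
  funext i
  obtain ⟨j, -, hj, hi⟩ := exists_lt_of_lt_count i.isLt
  have hA : S.A (Nat.nth (fun s => S.A s ω = m) i) ω = m := by
    rw [← hi, Nat.nth_count (p := fun s => S.A s ω = m) hj]; exact hj
  rw [partialRun, if_pos i.isLt, record, recordOf, hA]

/-- Sums over the rounds of the oracle are sums over the rounds in which it is selected. -/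
theorem sum_partialRun (S : Scheme Ω d M) (T : ℕ) (R : ℝ≥0) (x : ℕ → 𝒳) (m : Fin M) (ω : Ω)
    {φ : Record 𝒳 d → ℝ} (hφ : φ ((x 0, 0), (0, (0, 0))) = 0) :
    ∑ n : Fin T, φ (S.partialRun T R x m T n ω) =
      ∑ t ∈ Finset.range T, if S.A t ω = m then φ (S.recordOf T R x m t ω) else 0 := by
  rw [Fin.sum_univ_eq_sum_range (fun n => φ (S.partialRun T R x m T n ω)) T,
    ← sum_range_count_nth (fun s => S.A s ω = m) (fun t => φ (S.recordOf T R x m t ω)) T]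
  symm
  refine Finset.sum_subset_zero_on_sdiff (Finset.range_subset_range.2 (Nat.count_le _)) ?_ ?_
  · intro n hn
    rw [S.partialRun_of_count_le T R x (by simpa using (Finset.mem_sdiff.1 hn).2), hφ]
  · intro n hn
    rw [partialRun, if_pos (Finset.mem_range.1 hn)]

end

namespace IsRun

variable {𝒳 Ω : Type*} [MeasurableSpace 𝒳] [mΩ : MeasurableSpace Ω] {d M T : ℕ}
  {S : Scheme Ω d M} {P : Measure Ω} {orc : WeightedOracle 𝒳 d} {R : ℝ≥0}
  {μ : E d → 𝒳 → ℝ} {x : ℕ → 𝒳} {𝒜 : ℕ → Set (E d)} (hS : S.IsRun P orc T R μ x 𝒜)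
include hS

theorem measurable_recordOf {s t : ℕ} (hst : s < t) (hs : s < T) (m : Fin M) :
    Measurable[S.ℱ t] (S.recordOf T R x m s) := by
  have hl := hS.afterLoss_le hst hs
  have hw : Measurable[S.ℱ t] (S.weight T R s m) :=
    (hS.measurable_weight hs m).mono (S.ℱ.mono hst.le) le_rfl
  have h1 : Measurable[S.ℱ t] (S.pred s) := (S.measurable_pred_afterPred s).mono
    ((S.afterPred_le_afterAct s).trans ((S.afterAct_le_afterLoss s).trans hl)) le_rfl
  have h2 : Measurable[S.ℱ t] (S.act s) := (S.measurable_act_afterAct s).mono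
    ((S.afterAct_le_afterLoss s).trans hl) le_rfl
  have h3 : Measurable[S.ℱ t] (S.loss s) := (S.measurable_loss_afterLoss s).mono hl le_rfl
  exact (measurable_const.prodMk hw).prodMk (h1.prodMk (h2.prodMk h3))

theorem measurable_A_of_lt {s t : ℕ} (hst : s < t) (hs : s < T) : Measurable[S.ℱ t] (S.A s) :=
  (S.measurable_A_afterSelect s).mono ((S.afterSelect_le_afterPred s).trans
    ((S.afterPred_le_afterAct s).trans ((S.afterAct_le_afterLoss s).trans
      (hS.afterLoss_le hst hs)))) le_rfl

theorem measurable_partialRun {t : ℕ} (ht : t ≤ T) (m : Fin M) (n : ℕ) :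
    Measurable[S.ℱ t] (S.partialRun T R x m t n) :=
  @measurable_ite_nth Ω (Record 𝒳 d) (S.ℱ t) _ M S.A m (S.recordOf T R x m)
    ((x 0, 0), (0, (0, 0))) t (fun _ hs => hS.measurable_A_of_lt hs (hs.trans_le ht))
    (fun _ hs => hS.measurable_recordOf hs (hs.trans_le ht) m) n

theorem partialRun_mem_live_iff (hd : 0 < d) (m : Fin M) (n : Fin T) (ω : Ω) :
    (fun n : Fin T => S.partialRun T R x m T n ω) ∈ live n ↔
      (n : ℕ) < Nat.count (fun s => S.A s ω = m) T := by
  change (S.partialRun T R x m T n ω).1.2 ≠ 0 ↔ _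
  by_cases hn : (n : ℕ) < Nat.count (fun s => S.A s ω = m) T
  · simp only [hn, iff_true]
    obtain ⟨j, hjT, hj, hi⟩ := exists_lt_of_lt_count hn
    rw [← hi, S.partialRun_count T R x hjT hj]
    exact (hS.weight_pos hd hjT m ω).ne'
  · rw [S.partialRun_of_count_le T R x (not_lt.1 hn)]
    simp [hn]

/-- In every round of nonzero weight, the prediction of the partial run is drawn from the kernel of
the oracle. The round of the scheme to which a round of the oracle belongs is random, so that the
event is split according to it. -/
theorem predLawOn_live [IsProbabilityMeasure P] (hd : 0 < d) (m : Fin M) (n : Fin T) :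
    orc.PredLawOn (P.map fun ω (n : Fin T) => S.partialRun T R x m T n ω) n (live n) := by
  classical
  intro g hg
  have hk := orc.isMarkov n
  have hmeas : Measurable fun ω (n : Fin T) => S.partialRun T R x m T n ω :=
    measurable_pi_iff.2 fun n => (hS.measurable_partialRun le_rfl m n).mono (S.ℱ.le _) le_rfl
  have hl := measurableSet_live (𝒳 := 𝒳) (d := d) n
  have hg2 : Measurable fun u => ∫⁻ y, g (u, y) ∂orc.kernel n u := hg.lintegral_kernel_prod_right'
  have hG₁ : Measurable fun r : Fin T → Record 𝒳 d => g (pastCtx n r, (r n).2.1) := by fun_prop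
  rw [lintegral_map (hG₁.indicator hl) hmeas,
    lintegral_map ((orc.measurable_lintegral_kernel n hg).indicator hl) hmeas]
  -- the event that the `n`-th round of the oracle is round `t` of the scheme
  set D : ℕ → Set Ω := fun t =>
    S.A t ⁻¹' {m} ∩ (fun ω => Nat.count (fun s => S.A s ω = m) t) ⁻¹' {(n : ℕ)} with hD
  set Z : ℕ → Ω → (Fin n → Record 𝒳 d) × (𝒳 × ℝ) := fun t ω =>
    (fun i => S.partialRun T R x m t i ω, (x t, S.weight T R t m ω)) with hZ
  have hpast : ∀ t < T, ∀ ω ∈ D t,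
      pastCtx n (fun n : Fin T => S.partialRun T R x m T n ω) = Z t ω ∧
      (S.partialRun T R x m T n ω).2.1 = S.pred t ω := by
    rintro t ht ω ⟨h1, h2⟩
    have h1' : S.A t ω = m := h1
    have h2' : Nat.count (fun s => S.A s ω = m) t = n := h2
    have e : S.partialRun T R x m T n ω = S.recordOf T R x m t ω := by
      rw [← h2', S.partialRun_count T R x ht h1']
    refine ⟨Prod.ext (funext fun i => ?_) ?_, ?_⟩
    · exact S.partialRun_of_lt_count T R x ht.le (h2'.symm ▸ i.isLt)
    · change (S.partialRun T R x m T n ω).1 = _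
      rw [e]; rfl
    · rw [e]; rfl
  have hsplit : ∀ (G : (Fin T → Record 𝒳 d) → ℝ≥0∞) (H : ℕ → Ω → ℝ≥0∞),
      (∀ t < T, ∀ ω ∈ D t, G (fun n : Fin T => S.partialRun T R x m T n ω) = H t ω) →
      ∀ ω, (live n).indicator G (fun n : Fin T => S.partialRun T R x m T n ω)
        = ∑ t ∈ Finset.range T, (D t).indicator (H t) ω := by
    intro G H hGH ω
    by_cases hn : (n : ℕ) < Nat.count (fun s => S.A s ω = m) T
    · rw [Set.indicator_of_mem ((hS.partialRun_mem_live_iff hd m n ω).2 hn)]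
      obtain ⟨j, hjT, hj, hi⟩ := exists_lt_of_lt_count hn
      have hjD : ω ∈ D j := ⟨hj, hi⟩
      rw [Finset.sum_eq_single j, Set.indicator_of_mem hjD, hGH j hjT ω hjD]
      · intro t _ htj
        refine Set.indicator_of_notMem (fun hω => htj ?_) _
        have h1 : S.A t ω = m := hω.1
        have h2 : Nat.count (fun s => S.A s ω = m) t = n := hω.2
        exact Nat.count_injective (p := fun s => S.A s ω = m) h1 hj (h2.trans hi.symm)
      · exact fun h => absurd (Finset.mem_range.2 hjT) h
    · rw [Set.indicator_of_notMem (mt (hS.partialRun_mem_live_iff hd m n ω).1 hn)]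
      symm
      refine Finset.sum_eq_zero fun t ht => Set.indicator_of_notMem (fun hω => hn ?_) _
      have h1 : S.A t ω = m := hω.1
      have h2 : Nat.count (fun s => S.A s ω = m) t = n := hω.2
      exact h2 ▸ Nat.count_strict_mono (p := fun s => S.A s ω = m) h1 (Finset.mem_range.1 ht)
  simp only [hsplit (fun r => g (pastCtx n r, (r n).2.1)) (fun t ω => g (Z t ω, S.pred t ω))
      (fun t ht ω hω => by
        simp only [(hpast t ht ω hω).1, (hpast t ht ω hω).2]),
    hsplit (fun r => ∫⁻ y, g (pastCtx n r, y) ∂orc.kernel n (pastCtx n r))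
      (fun t ω => ∫⁻ y, g (Z t ω, y) ∂orc.kernel n (Z t ω)) (fun t ht ω hω => by
        simp only [(hpast t ht ω hω).1])]
  have hDm : ∀ t < T, MeasurableSet[S.afterSelect t] (D t) := fun t ht =>
    @MeasurableSet.inter Ω (S.afterSelect t) _ _
      (S.measurable_A_afterSelect t (measurableSet_singleton m))
      (S.ℱ_le_afterSelect t _ (@measurable_count Ω (S.ℱ t) M S.A m t
        (fun s hs => hS.measurable_A_of_lt hs (hs.trans ht)) {(n : ℕ)} (measurableSet_singleton _)))
  have hZm : ∀ t < T, Measurable[S.afterSelect t] (Z t) := fun t ht =>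
    Measurable.mono (Measurable.prodMk
      (@measurable_pi_lambda _ _ _ (S.ℱ t) _ _ fun i => hS.measurable_partialRun ht.le m i)
      (measurable_const.prodMk (hS.measurable_weight ht m))) (S.ℱ_le_afterSelect t) le_rfl
  have hDm' := fun t ht => hS.afterSelect_le ht _ (hDm t ht)
  have hZm' := fun t ht => (hZm t ht).mono (hS.afterSelect_le ht) le_rfl
  rw [lintegral_finsetSum' _ fun t ht => ?_, lintegral_finsetSum' _ fun t ht => ?_]
  · refine Finset.sum_congr rfl fun t ht => ?_
    have htT := Finset.mem_range.1 ht
    -- integrate out the prediction, conditionally on the selection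
    have h := HasCondLaw.lintegral_eq (hS.afterSelect_le htT) (hS.measurable_pred t htT)
      (fun ω => (orc.isMarkov _).isProbabilityMeasure _) (hS.predict t htT)
      (g := fun z => (D t).indicator (fun ω => g (Z t ω, z.2)) z.1) (by
        let := S.afterSelect t
        have h1 : Measurable fun z : Ω × E d => g (Z t z.1, z.2) :=
          hg.comp (((hZm t htT).comp measurable_fst).prodMk measurable_snd)
        exact h1.indicator (measurable_fst (hDm t htT)))
    refine h.trans (lintegral_congr fun ω => ?_)
    by_cases hω : ω ∈ D t
    · simp only [Set.indicator_of_mem hω]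
      exact congrArg (fun κ : Measure (E d) => ∫⁻ b, g (Z t ω, b) ∂κ)
        (S.predLaw_eq orc T R x hω.1 hω.2)
    · simp [Set.indicator_of_notMem hω]
  · have htT := Finset.mem_range.1 ht
    exact ((hg2.comp (hZm' t htT)).indicator (hDm' t htT)).aemeasurable
  · have htT := Finset.mem_range.1 ht
    exact ((hg.comp ((hZm' t htT).prodMk (hS.measurable_pred t htT))).indicator
      (hDm' t htT)).aemeasurable

/-- The regret bound of the oracle for the rounds in which base algorithm `m` is selected. -/
theorem lintegral_loss_le [IsProbabilityMeasure P] {F : Set (𝒳 → E d)} (horc : orc.HasRegret F T R)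
    (hd : 0 < d) (h𝒜 : ∀ t < T, 𝒜 t ⊆ Metric.closedBall (0 : E d) 1) (m : Fin M) {f : 𝒳 → E d}
    (hf : f ∈ F) {W : Ω → ℝ≥0∞} (hW : ∀ ω, ∀ t < T, ENNReal.ofReal (S.weight T R t m ω) ≤ W ω) :
    ∫⁻ ω, ENNReal.ofReal (∑ t ∈ Finset.range T, if S.A t ω = m then S.weight T R t m ω *
        (inner ℝ (S.act t ω) (S.pred t ω) - S.loss t ω) ^ 2 else 0) ∂P
      ≤ ∫⁻ ω, ENNReal.ofReal (∑ t ∈ Finset.range T, if S.A t ω = m then S.weight T R t m ω *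
        (inner ℝ (S.act t ω) (f (x t)) - S.loss t ω) ^ 2 else 0) ∂P + (∫⁻ ω, W ω ∂P) * R := by
  have hmeas : Measurable fun ω (n : Fin T) => S.partialRun T R x m T n ω :=
    measurable_pi_iff.2 fun n => (hS.measurable_partialRun le_rfl m n).mono (S.ℱ.le _) le_rfl
  have hprob : IsProbabilityMeasure (P.map fun ω (n : Fin T) => S.partialRun T R x m T n ω) :=
    Measure.isProbabilityMeasure_map hmeas.aemeasurable
  have hcases : ∀ (ω : Ω) (n : ℕ), (∃ t < T, S.partialRun T R x m T n ω = S.recordOf T R x m t ω) ∨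
      S.partialRun T R x m T n ω = ((x 0, 0), (0, (0, 0))) := by
    intro ω n
    by_cases hn : n < Nat.count (fun s => S.A s ω = m) T
    · obtain ⟨j, hjT, hj, hi⟩ := exists_lt_of_lt_count hn
      exact Or.inl ⟨j, hjT, by rw [← hi, S.partialRun_count T R x hjT hj]⟩
    · exact Or.inr (S.partialRun_of_count_le T R x (not_lt.1 hn))
  have hae : ∀ p : Record 𝒳 d → Prop, MeasurableSet {z | p z} →
      (∀ ω, ∀ t < T, p (S.recordOf T R x m t ω)) → p ((x 0, 0), (0, (0, 0))) →
      ∀ᵐ r ∂(P.map fun ω (n : Fin T) => S.partialRun T R x m T n ω), ∀ n, p (r n) := by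
    intro p hp h1 h2
    refine ae_all_iff.2 fun n => ?_
    rw [ae_map_iff (p := fun r : Fin T → Record 𝒳 d => p (r n)) hmeas.aemeasurable
      (measurable_pi_apply n hp)]
    refine .of_forall fun ω => ?_
    dsimp only
    rcases hcases ω n with ⟨t, ht, e⟩ | e <;> rw [e]
    · exact h1 ω t ht
    · exact h2
  have h := horc.of_partial_run (hS.predLawOn_live hd m) (by
      have : ∀ k n : Fin T, k ≤ n →
          ∀ᵐ r ∂(P.map fun ω (n : Fin T) => S.partialRun T R x m T n ω),
            r ∈ live n → r ∈ live k := by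
        intro k n hkn
        have hms : MeasurableSet {r : Fin T → Record 𝒳 d | r ∈ live n → r ∈ live k} := by
          have e : {r : Fin T → Record 𝒳 d | r ∈ live n → r ∈ live k} = (live n)ᶜ ∪ live k := by
            ext r; simp [imp_iff_not_or]
          rw [e]
          exact (measurableSet_live n).compl.union (measurableSet_live k)
        rw [ae_map_iff hmeas.aemeasurable hms]
        refine .of_forall fun ω hω => ?_
        rw [hS.partialRun_mem_live_iff hd] at hω ⊢
        exact lt_of_le_of_lt hkn hω
      exact ae_all_iff.2 fun k => ae_all_iff.2 fun n => by
        by_cases hkn : k ≤ n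
        · exact (this k n hkn).mono fun r hr _ => hr
        · exact .of_forall fun r h => absurd h hkn)
    (hae (fun z => 0 ≤ z.1.2) (measurableSet_le measurable_const (by fun_prop))
      (fun ω t ht => (hS.weight_pos hd ht m ω).le) le_rfl)
    (hae (fun z => z.2.2.1 ∈ Metric.closedBall (0 : E d) 1)
      ((by fun_prop : Measurable fun z : Record 𝒳 d => z.2.2.1)
        Metric.isClosed_closedBall.measurableSet)
      (fun ω t ht => h𝒜 t ht (hS.act_mem t ht ω)) (by simp))
    (hae (fun z => z.2.2.2 ∈ Set.Icc (-1 : ℝ) 1)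
      ((by fun_prop : Measurable fun z : Record 𝒳 d => z.2.2.2) measurableSet_Icc)
      (fun ω t ht => hS.loss_mem t ht ω) (by simp)) hf
  rw [lintegral_map (by fun_prop) hmeas] at h
  have e1 : ∀ ω, ∑ n : Fin T, (S.partialRun T R x m T n ω).1.2 *
      (inner ℝ (S.partialRun T R x m T n ω).2.2.1 (S.partialRun T R x m T n ω).2.1
        - (S.partialRun T R x m T n ω).2.2.2) ^ 2
      = ∑ t ∈ Finset.range T, if S.A t ω = m then S.weight T R t m ω *
        (inner ℝ (S.act t ω) (S.pred t ω) - S.loss t ω) ^ 2 else 0 := fun ω =>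
    S.sum_partialRun T R x m ω
      (φ := fun z => z.1.2 * (inner ℝ z.2.2.1 z.2.1 - z.2.2.2) ^ 2) (by simp)
  have e2 : ∀ ω, ∑ n : Fin T, (S.partialRun T R x m T n ω).1.2 *
      (inner ℝ (S.partialRun T R x m T n ω).2.2.1 (f (S.partialRun T R x m T n ω).1.1)
        - (S.partialRun T R x m T n ω).2.2.2) ^ 2
      = ∑ t ∈ Finset.range T, if S.A t ω = m then S.weight T R t m ω *
        (inner ℝ (S.act t ω) (f (x t)) - S.loss t ω) ^ 2 else 0 := fun ω =>
    S.sum_partialRun T R x m ω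
      (φ := fun z => z.1.2 * (inner ℝ z.2.2.1 (f z.1.1) - z.2.2.2) ^ 2) (by simp)
  simp only [e1] at h
  have e3 : ∫⁻ r, ⨆ n, ENNReal.ofReal (r n).1.2
      ∂(P.map fun ω (n : Fin T) => S.partialRun T R x m T n ω) ≤ ∫⁻ ω, W ω ∂P := by
    refine (lintegral_map_le _ _).trans (lintegral_mono fun ω => iSup_le fun n => ?_)
    dsimp only
    rcases hcases ω n with ⟨t, ht, e⟩ | e <;> rw [e]
    · exact hW ω t ht
    · simp
  refine h.trans (add_le_add ((lintegral_map_le _ _).trans ?_) (mul_le_mul_left e3 _))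
  simp only [e2]; exact le_rfl

end IsRun

end Scheme

/-! ### Misspecification of a single function -/

section Misspecification

variable {𝒳 : Type*} {d T : ℕ} {μ : E d → 𝒳 → ℝ} {x : ℕ → 𝒳} {𝒜 : ℕ → Set (E d)}

/-- The largest error `sup_{a ∈ 𝒜ₜ} |⟨a, f xₜ⟩ - μ(a, xₜ)|` of `f` in round `t`. -/
noncomputable def supError (f : 𝒳 → E d) (μ : E d → 𝒳 → ℝ) (x : ℕ → 𝒳) (𝒜 : ℕ → Set (E d))
    (t : ℕ) : ℝ :=
  √(⨆ a : 𝒜 t, (inner ℝ a.1 (f (x t)) - μ a.1 (x t)) ^ 2)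

theorem supError_sq (f : 𝒳 → E d) (μ : E d → 𝒳 → ℝ) (x : ℕ → 𝒳) (𝒜 : ℕ → Set (E d)) (t : ℕ) :
    supError f μ x 𝒜 t ^ 2 = ⨆ a : 𝒜 t, (inner ℝ a.1 (f (x t)) - μ a.1 (x t)) ^ 2 :=
  Real.sq_sqrt (Real.iSup_nonneg fun _ => sq_nonneg _)

theorem supError_nonneg (f : 𝒳 → E d) (μ : E d → 𝒳 → ℝ) (x : ℕ → 𝒳) (𝒜 : ℕ → Set (E d)) (t : ℕ) :
    0 ≤ supError f μ x 𝒜 t := Real.sqrt_nonneg _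

theorem abs_inner_le_of_mem_ball {a : E d} (ha : a ∈ Metric.closedBall (0 : E d) 1) (v : E d) :
    |(inner ℝ a v : ℝ)| ≤ ‖v‖ := by
  have h1 := abs_real_inner_le_norm a v
  have h2 : ‖a‖ ≤ 1 := by simpa using ha
  nlinarith [norm_nonneg v]

theorem abs_error_le (hμ : ∀ a ∈ Metric.closedBall (0 : E d) 1, ∀ y, μ a y ∈ Set.Icc (-1 : ℝ) 1)
    {t : ℕ} (h𝒜 : 𝒜 t ⊆ Metric.closedBall 0 1) (f : 𝒳 → E d) {a : E d} (ha : a ∈ 𝒜 t) :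
    |inner ℝ a (f (x t)) - μ a (x t)| ≤ supError f μ x 𝒜 t := by
  refine Real.abs_le_sqrt (le_ciSup (f := fun a : 𝒜 t =>
    (inner ℝ a.1 (f (x t)) - μ a.1 (x t)) ^ 2) ⟨(‖f (x t)‖ + 1) ^ 2, ?_⟩ ⟨a, ha⟩)
  rintro _ ⟨b, rfl⟩
  have h1 := abs_inner_le_of_mem_ball (h𝒜 b.2) (f (x t))
  have h2 : |μ b.1 (x t)| ≤ 1 := abs_le.2 (hμ _ (h𝒜 b.2) _)
  have h3 := abs_sub (inner ℝ b.1 (f (x t)) : ℝ) (μ b.1 (x t))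
  have h4 := abs_le.1 (h3.trans (add_le_add h1 h2))
  exact sq_le_sq' h4.1 h4.2

/-- Up to twice the largest error of `f`, the regret of an action is its regret for the linear
losses given by `f`. -/
theorem sub_iInf_le (hμ : ∀ a ∈ Metric.closedBall (0 : E d) 1, ∀ y, μ a y ∈ Set.Icc (-1 : ℝ) 1)
    {t : ℕ} (h𝒜 : 𝒜 t ⊆ Metric.closedBall 0 1) (f : 𝒳 → E d) {a : E d} (ha : a ∈ 𝒜 t) :
    μ a (x t) - ⨅ b : 𝒜 t, μ b.1 (x t) ≤
      (inner ℝ a (f (x t)) - ⨅ b : 𝒜 t, inner ℝ b.1 (f (x t))) + 2 * supError f μ x 𝒜 t := by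
  have hne : Nonempty (𝒜 t) := ⟨⟨a, ha⟩⟩
  have hbdd : BddBelow (Set.range fun b : 𝒜 t => (inner ℝ b.1 (f (x t)) : ℝ)) := by
    refine ⟨-‖f (x t)‖, ?_⟩
    rintro _ ⟨b, rfl⟩
    exact (abs_le.1 (abs_inner_le_of_mem_ball (h𝒜 b.2) (f (x t)))).1
  have h1 : (⨅ b : 𝒜 t, (inner ℝ b.1 (f (x t)) : ℝ)) - supError f μ x 𝒜 t
      ≤ ⨅ b : 𝒜 t, μ b.1 (x t) := by
    refine le_ciInf fun b => ?_
    have h2 := ciInf_le hbdd b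
    have h3 := (abs_le.1 (abs_error_le (x := x) hμ h𝒜 f b.2)).2
    linarith
  have h4 := (abs_le.1 (abs_error_le (x := x) hμ h𝒜 f ha)).1
  linarith

/-- The sums over the rounds of the errors of `f` and of their squares, in terms of the quadratic
mean `ε` of the errors. -/
theorem sum_supError_le (hT : 0 < T) (f : 𝒳 → E d) (μ : E d → 𝒳 → ℝ) (x : ℕ → 𝒳)
    (𝒜 : ℕ → Set (E d)) {ε : ℝ} (hε : ε = √((1 / (T : ℝ)) * ∑ t ∈ Finset.range T,
      ⨆ a : 𝒜 t, (inner ℝ a.1 (f (x t)) - μ a.1 (x t)) ^ 2)) :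
    ∑ t ∈ Finset.range T, supError f μ x 𝒜 t ^ 2 = T * ε ^ 2 ∧
      ∑ t ∈ Finset.range T, supError f μ x 𝒜 t ≤ T * ε := by
  have hT' : (0 : ℝ) < T := by exact_mod_cast hT
  have h1 : ∑ t ∈ Finset.range T, supError f μ x 𝒜 t ^ 2 = T * ε ^ 2 := by
    simp only [← supError_sq] at hε
    rw [hε, Real.sq_sqrt (mul_nonneg (by positivity) (Finset.sum_nonneg fun _ _ => sq_nonneg _))]
    field_simp
  refine ⟨h1, ?_⟩
  have h2 := sq_sum_le_card_mul_sum_sq (s := Finset.range T) (f := supError f μ x 𝒜)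
  rw [h1, Finset.card_range] at h2
  have hε0 : 0 ≤ ε := hε ▸ Real.sqrt_nonneg _
  exact (sq_le_sq₀ (Finset.sum_nonneg fun t _ => supError_nonneg f μ x 𝒜 t) (by positivity)).1
    (h2.trans_eq (by ring))

end Misspecification

/-! ### Importance weighting -/

namespace Scheme

variable {𝒳 Ω : Type*} [MeasurableSpace 𝒳] [mΩ : MeasurableSpace Ω] {d M T : ℕ}
  {S : Scheme Ω d M} {P : Measure Ω} {orc : WeightedOracle 𝒳 d} {R : ℝ≥0}
  {μ : E d → 𝒳 → ℝ} {x : ℕ → 𝒳} {𝒜 : ℕ → Set (E d)}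

/-- The importance weight `1{A_t = m} / q_{t,m}`. -/
noncomputable def impWeight (S : Scheme Ω d M) (t : ℕ) (m : Fin M) (ω : Ω) : ℝ :=
  (if S.A t ω = m then 1 else 0) / S.q t ω m

theorem ite_weight_mul (S : Scheme Ω d M) (T : ℕ) (R : ℝ≥0) (t : ℕ) (m : Fin M) (ω : Ω) (c : ℝ) :
    (if S.A t ω = m then S.weight T R t m ω * c else 0)
      = S.impWeight t m ω * S.gamma T R t m ω * c := by
  rw [impWeight, weight]
  split_ifs <;> ring

namespace IsRun

variable (hS : S.IsRun P orc T R μ x 𝒜)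
include hS

theorem impWeight_nonneg {t : ℕ} (ht : t < T) (m : Fin M) (ω : Ω) : 0 ≤ S.impWeight t m ω := by
  have := hS.q_pos t ht ω m
  rw [impWeight]; positivity

theorem measurable_impWeight {t : ℕ} (ht : t < T) (m : Fin M) :
    Measurable[S.afterSelect t] (S.impWeight t m) := by
  have h1 := (hS.measurable_q le_rfl ht m).mono (S.ℱ_le_afterSelect t) le_rfl
  have h2 := S.measurable_A_afterSelect t (measurableSet_singleton m)
  let := S.afterSelect t
  exact Measurable.div (Measurable.ite h2 measurable_const measurable_const) h1

/-- Importance weighting undoes the random selection. -/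
theorem lintegral_impWeight_mul [IsProbabilityMeasure P] {t : ℕ} (ht : t < T) (m : Fin M)
    {Z : Ω → ℝ≥0∞} (hZ : Measurable[S.ℱ t] Z) :
    ∫⁻ ω, ENNReal.ofReal (S.impWeight t m ω) * Z ω ∂P = ∫⁻ ω, Z ω ∂P := by
  have hq := hS.measurable_q le_rfl ht m
  have hm : Measurable[S.ℱ t] fun ω => ENNReal.ofReal (S.q t ω m)⁻¹ * Z ω := by
    let := S.ℱ t
    exact (Measurable.inv hq).ennreal_ofReal.mul hZ
  have h := lintegral_indicator_of_condProb (S.ℱ.le t)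
    (hS.measurable_A t ht (measurableSet_singleton m)) hq (fun ω => (hS.q_pos t ht ω m).le)
    (hS.select t ht m) hm
  have e1 : ∀ ω, (S.A t ⁻¹' {m}).indicator (fun ω => ENNReal.ofReal (S.q t ω m)⁻¹ * Z ω) ω
      = ENNReal.ofReal (S.impWeight t m ω) * Z ω := by
    intro ω
    by_cases hω : S.A t ω = m
    · rw [Set.indicator_of_mem (show ω ∈ S.A t ⁻¹' {m} from hω), impWeight, if_pos hω, one_div]
    · rw [Set.indicator_of_notMem (show ω ∉ S.A t ⁻¹' {m} from hω), impWeight, if_neg hω]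
      simp
  have e2 : ∀ ω, ENNReal.ofReal (S.q t ω m) * (ENNReal.ofReal (S.q t ω m)⁻¹ * Z ω) = Z ω := by
    intro ω
    have hpos := hS.q_pos t ht ω m
    rw [← mul_assoc, ← ENNReal.ofReal_mul hpos.le, mul_inv_cancel₀ hpos.ne', ENNReal.ofReal_one,
      one_mul]
  simp only [e1, e2] at h
  exact h

theorem lintegral_act [IsProbabilityMeasure P] {t : ℕ} (ht : t < T) {k : Ω → ℝ≥0∞}
    (hk : Measurable[S.afterPred t] k) {φ : E d × E d → ℝ≥0∞} (hφ : Measurable φ) :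
    ∫⁻ ω, k ω * φ (S.pred t ω, S.act t ω) ∂P
      = ∫⁻ ω, k ω * ∫⁻ b, φ (S.pred t ω, b) ∂(S.p t ω).toMeasure ∂P := by
  have hp := S.measurable_pred_afterPred t
  have h := HasCondLaw.lintegral_eq (hS.afterPred_le ht) (hS.measurable_act t ht)
    (fun ω => inferInstance) (hS.act_law t ht) (g := fun z => k z.1 * φ (S.pred t z.1, z.2)) (by
      let := S.afterPred t
      exact (hk.comp measurable_fst).mul
        (hφ.comp ((hp.comp measurable_fst).prodMk measurable_snd)))
  rw [h]
  refine lintegral_congr fun ω => ?_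
  have hm : Measurable fun b => φ (S.pred t ω, b) := hφ.comp (measurable_const.prodMk measurable_id)
  exact lintegral_const_mul (k ω) hm

/-- The expected importance-weighted regret of round `t` for the linear losses given by `θ'`, by the
guarantee of the log-determinant barrier. -/
theorem lintegral_linear_regret_le [IsProbabilityMeasure P] (hd : 0 < d)
    {t : ℕ} (ht : t < T) (h𝒜 : 𝒜 t ⊆ Metric.closedBall 0 1) (m : Fin M) (θ' : E d) :
    ∫⁻ ω, ENNReal.ofReal (S.impWeight t m ω) *
        ENNReal.ofReal (inner ℝ (S.act t ω) θ' - ⨅ b : 𝒜 t, inner ℝ b.1 θ') ∂P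
      ≤ ∫⁻ ω, ENNReal.ofReal (d / S.gamma T R t m ω) ∂P
        + ENNReal.ofReal (1 / 4) * ∫⁻ ω, ENNReal.ofReal
          (S.impWeight t m ω * S.gamma T R t m ω * (inner ℝ (S.act t ω) (S.pred t ω - θ')) ^ 2)
            ∂P := by
  set c : ℝ := ⨅ b : 𝒜 t, inner ℝ b.1 θ' with hc
  have hκ := (hS.measurable_impWeight ht m).mono (S.afterSelect_le_afterPred t) le_rfl
  have hγ := hS.measurable_gamma ht m
  have hγ' := hγ.mono ((S.ℱ_le_afterSelect t).trans (S.afterSelect_le_afterPred t)) le_rfl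
  have hκ0 := hS.impWeight_nonneg ht m
  have hγ0 := hS.gamma_pos hd ht m
  have hk1 : Measurable[S.afterPred t] fun ω => ENNReal.ofReal (S.impWeight t m ω) := by
    let := S.afterPred t
    exact Measurable.ennreal_ofReal hκ
  have hk2 : Measurable[S.afterPred t] fun ω =>
      ENNReal.ofReal (S.impWeight t m ω * S.gamma T R t m ω) := by
    let := S.afterPred t
    exact Measurable.ennreal_ofReal (Measurable.mul hκ hγ')
  have hdγ : Measurable[S.ℱ t] fun ω => ENNReal.ofReal (d / S.gamma T R t m ω) := by
    let := S.ℱ t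
    exact Measurable.ennreal_ofReal (Measurable.const_div hγ _)
  have hbdd : BddBelow (Set.range fun b : 𝒜 t => (inner ℝ b.1 θ' : ℝ)) := by
    refine ⟨-‖θ'‖, ?_⟩
    rintro _ ⟨b, rfl⟩
    exact (abs_le.1 (abs_inner_le_of_mem_ball (h𝒜 b.2) θ')).1
  have h1 := hS.lintegral_act ht hk1 (φ := fun z => ENNReal.ofReal (inner ℝ z.2 θ' - c))
    (by fun_prop)
  have h2 := hS.lintegral_act ht hk2
    (φ := fun z => ENNReal.ofReal ((inner ℝ z.2 (z.1 - θ')) ^ 2)) (by fun_prop)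
  have e2 : ∀ ω, ENNReal.ofReal
      (S.impWeight t m ω * S.gamma T R t m ω * (inner ℝ (S.act t ω) (S.pred t ω - θ')) ^ 2)
      = ENNReal.ofReal (S.impWeight t m ω * S.gamma T R t m ω) *
        ENNReal.ofReal ((inner ℝ (S.act t ω) (S.pred t ω - θ')) ^ 2) := fun ω =>
    ENNReal.ofReal_mul (mul_nonneg (hκ0 ω) (hγ0 ω).le)
  have hmul : Measurable fun ω => ENNReal.ofReal (S.impWeight t m ω) *
      ENNReal.ofReal (d / S.gamma T R t m ω) :=
    (hk1.mono (hS.afterPred_le ht) le_rfl).mul (hdγ.mono (S.ℱ.le t) le_rfl)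
  simp only [e2]
  rw [h1, h2, ← hS.lintegral_impWeight_mul ht m hdγ,
    ← lintegral_const_mul' _ _ ENNReal.ofReal_ne_top, ← lintegral_add_left hmul]
  refine lintegral_mono fun ω => ?_
  dsimp only
  by_cases hA : S.A t ω = m
  swap
  · rw [impWeight, if_neg hA]; simp
  have hbar := hS.barrier t ht ω
  rw [hA] at hbar
  have hsup := hbar.1.trans h𝒜
  have hne : Nonempty (𝒜 t) := ⟨⟨_, hS.act_mem t ht ω⟩⟩
  have hmain : inner ℝ (meanAction (S.p t ω)) θ' - c ≤ d / S.gamma T R t m ω + S.gamma T R t m ω / 4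
      * ∫ b, (inner ℝ b (S.pred t ω - θ')) ^ 2 ∂(S.p t ω).toMeasure := by
    have : inner ℝ (meanAction (S.p t ω)) θ' - (d / S.gamma T R t m ω + S.gamma T R t m ω / 4
      * ∫ b, (inner ℝ b (S.pred t ω - θ')) ^ 2 ∂(S.p t ω).toMeasure) ≤ c := by
      refine le_ciInf fun b => ?_
      have := hbar.inner_sub_le (hγ0 ω) h𝒜 θ' b.2
      linarith
    linarith
  have i1 : ∫⁻ b, ENNReal.ofReal (inner ℝ b θ' - c) ∂(S.p t ω).toMeasure
      = ENNReal.ofReal (inner ℝ (meanAction (S.p t ω)) θ' - c) := by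
    rw [← ofReal_integral_eq_lintegral_ofReal (integrable_of_support_subset_ball hsup
      (by fun_prop)) ((ae_mem_of_support_subset hbar.1).mono fun b hb => sub_nonneg.2
        (ciInf_le hbdd (⟨b, hb⟩ : 𝒜 t))), integral_sub (integrable_of_support_subset_ball hsup
        (by fun_prop)) (integrable_const c), ← inner_meanAction hsup]
    simp
  have i2 : ∫⁻ b, ENNReal.ofReal ((inner ℝ b (S.pred t ω - θ')) ^ 2) ∂(S.p t ω).toMeasure
      = ENNReal.ofReal (∫ b, (inner ℝ b (S.pred t ω - θ')) ^ 2 ∂(S.p t ω).toMeasure) := by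
    rw [← ofReal_integral_eq_lintegral_ofReal (integrable_of_support_subset_ball hsup
      (by fun_prop)) (.of_forall fun b => sq_nonneg _)]
  rw [i1, i2]
  set I := ∫ b, (inner ℝ b (S.pred t ω - θ')) ^ 2 ∂(S.p t ω).toMeasure
  have hI : 0 ≤ I := integral_nonneg fun b => sq_nonneg _
  have hγω := hγ0 ω
  have hκω := hκ0 ω
  rw [← ENNReal.ofReal_mul hκω, ← ENNReal.ofReal_mul hκω,
    ← ENNReal.ofReal_mul (mul_nonneg hκω hγω.le), ← ENNReal.ofReal_mul (by norm_num),
    ← ENNReal.ofReal_add (by positivity) (by positivity)]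
  refine ENNReal.ofReal_le_ofReal ?_
  have := mul_le_mul_of_nonneg_left hmain hκω
  linarith

end IsRun

end Scheme

/-! ### From the regret of the oracle to the squared prediction error -/

namespace Scheme.IsRun

variable {𝒳 Ω : Type*} [MeasurableSpace 𝒳] [mΩ : MeasurableSpace Ω] {d M T : ℕ}
  {S : Scheme Ω d M} {P : Measure Ω} {orc : WeightedOracle 𝒳 d} {R : ℝ≥0}
  {μ : E d → 𝒳 → ℝ} {x : ℕ → 𝒳} {𝒜 : ℕ → Set (E d)} (hS : S.IsRun P orc T R μ x 𝒜)
include hS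

/-- The regret bound of the oracle with `max w · Reg_Sq` bounded by `√(d T ρ Reg_Sq)`. -/
theorem lintegral_weighted_loss_le [IsProbabilityMeasure P] {F : Set (𝒳 → E d)}
    (horc : orc.HasRegret F T R) (hd : 0 < d)
    (h𝒜 : ∀ t < T, 𝒜 t ⊆ Metric.closedBall (0 : E d) 1) (m : Fin M) {f : 𝒳 → E d} (hf : f ∈ F) :
    ∫⁻ ω, ENNReal.ofReal (∑ t ∈ Finset.range T, S.impWeight t m ω * S.gamma T R t m ω *
        (inner ℝ (S.act t ω) (S.pred t ω) - S.loss t ω) ^ 2) ∂P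
      ≤ ∫⁻ ω, ENNReal.ofReal (∑ t ∈ Finset.range T, S.impWeight t m ω * S.gamma T R t m ω *
        (inner ℝ (S.act t ω) (f (x t)) - S.loss t ω) ^ 2) ∂P
        + (∫⁻ ω, ENNReal.ofReal √(S.rho (T - 1) m ω) ∂P) * ENNReal.ofReal √(d * T * R) := by
  by_cases hR : R = 0
  · have h := hS.lintegral_loss_le horc hd h𝒜 m hf (W := fun _ => ⊤) (fun _ _ _ => le_top)
    simp only [ite_weight_mul] at h
    refine h.trans (add_le_add le_rfl ?_)
    simp [hR]
  · have hR0 : (R : ℝ≥0∞) ≠ 0 := by exact_mod_cast hR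
    have hRt : (R : ℝ≥0∞) ≠ ⊤ := ENNReal.coe_ne_top
    have h := hS.lintegral_loss_le horc hd h𝒜 m hf
      (W := fun ω => ENNReal.ofReal √(S.rho (T - 1) m ω) * ENNReal.ofReal √(d * T * R) / R) (by
        intro ω t ht
        rw [ENNReal.le_div_iff_mul_le (Or.inl hR0) (Or.inl hRt), ← ENNReal.ofReal_coe_nnreal,
          ← ENNReal.ofReal_mul (hS.weight_pos hd ht m ω).le,
          ← ENNReal.ofReal_mul (Real.sqrt_nonneg _), mul_comm √(S.rho (T - 1) m ω)]
        exact ENNReal.ofReal_le_ofReal (hS.weight_mul_le ht m ω))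
    simp only [ite_weight_mul] at h
    refine h.trans (add_le_add le_rfl ?_)
    rw [← lintegral_mul_const' _ _ hRt, ← lintegral_mul_const' _ _ ENNReal.ofReal_ne_top]
    refine lintegral_mono fun ω => ?_
    dsimp only
    rw [ENNReal.div_mul_cancel hR0 hRt]

/-- `𝔼[1{A_t = m} w_t] = 𝔼[γ_{t,m}]` is at most `√d / ε'_m`. -/
theorem integrable_impWeight_mul_gamma [IsProbabilityMeasure P] (hd : 0 < d) {t : ℕ} (ht : t < T)
    (m : Fin M) :
    Integrable (fun ω => S.impWeight t m ω * S.gamma T R t m ω) P ∧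
      ∫ ω, S.impWeight t m ω * S.gamma T R t m ω ∂P ≤ √d / gridEps m := by
  have hκ := (hS.measurable_impWeight ht m).mono (hS.afterSelect_le ht) le_rfl
  have hγ := hS.measurable_gamma ht m
  have hm : Measurable fun ω => S.impWeight t m ω * S.gamma T R t m ω :=
    hκ.mul (hγ.mono (S.ℱ.le t) le_rfl)
  have h0 : ∀ ω, 0 ≤ S.impWeight t m ω * S.gamma T R t m ω := fun ω =>
    mul_nonneg (hS.impWeight_nonneg ht m ω) (hS.gamma_pos hd ht m ω).le
  have hγ' : Measurable[S.ℱ t] fun ω => ENNReal.ofReal (S.gamma T R t m ω) := by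
    let := S.ℱ t
    exact Measurable.ennreal_ofReal hγ
  have hb : ∫⁻ ω, ENNReal.ofReal (S.impWeight t m ω * S.gamma T R t m ω) ∂P
      ≤ ENNReal.ofReal (√d / gridEps m) := by
    simp only [fun ω => ENNReal.ofReal_mul (q := S.gamma T R t m ω) (hS.impWeight_nonneg ht m ω)]
    rw [hS.lintegral_impWeight_mul ht m hγ']
    calc ∫⁻ ω, ENNReal.ofReal (S.gamma T R t m ω) ∂P
        ≤ ∫⁻ _, ENNReal.ofReal (√d / gridEps m) ∂P :=
          lintegral_mono fun ω => ENNReal.ofReal_le_ofReal (S.gamma_le T R t m ω)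
      _ = _ := by simp
  refine ⟨⟨hm.aestronglyMeasurable, ?_⟩, ?_⟩
  · rw [hasFiniteIntegral_iff_ofReal (.of_forall h0)]
    exact hb.trans_lt ENNReal.ofReal_lt_top
  · rw [integral_eq_lintegral_of_nonneg_ae (.of_forall h0) hm.aestronglyMeasurable]
    exact ENNReal.toReal_le_of_le_ofReal (div_nonneg (Real.sqrt_nonneg _) (gridEps_pos m).le) hb

/-- The expected weighted squared difference of the predictions of the oracle and of `f` is bounded
by the regret of the oracle and the error of `f`. In expectation the loss may be replaced by its
conditional mean, which differs from the prediction of `f` by at most the error of `f`. -/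
theorem sum_lintegral_sq_le [IsProbabilityMeasure P] {F : Set (𝒳 → E d)}
    (horc : orc.HasRegret F T R) (hd : 0 < d)
    (hμ : ∀ a ∈ Metric.closedBall (0 : E d) 1, ∀ y, μ a y ∈ Set.Icc (-1 : ℝ) 1)
    (h𝒜 : ∀ t < T, 𝒜 t ⊆ Metric.closedBall (0 : E d) 1) (m : Fin M) {f : 𝒳 → E d} (hf : f ∈ F) :
    ENNReal.ofReal (1 / 4) * ∑ t ∈ Finset.range T, ∫⁻ ω, ENNReal.ofReal
        (S.impWeight t m ω * S.gamma T R t m ω *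
          (inner ℝ (S.act t ω) (S.pred t ω - f (x t))) ^ 2) ∂P
      ≤ ENNReal.ofReal (1 / 2) * ((∫⁻ ω, ENNReal.ofReal √(S.rho (T - 1) m ω) ∂P) *
          ENNReal.ofReal √(d * T * R))
        + ENNReal.ofReal (√d / gridEps m * ∑ t ∈ Finset.range T, supError f μ x 𝒜 t ^ 2) := by
  set C := (∫⁻ ω, ENNReal.ofReal √(S.rho (T - 1) m ω) ∂P) * ENNReal.ofReal √(d * T * R) with hC
  by_cases hCt : C = ⊤
  · rw [hCt, ENNReal.mul_top (by simp), top_add]; exact le_top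
  have hreg := hS.lintegral_weighted_loss_le horc hd h𝒜 m hf
  rw [← hC] at hreg
  set g : ℕ → Ω → ℝ := fun t ω => S.impWeight t m ω * S.gamma T R t m ω with hg
  set u : ℕ → Ω → ℝ := fun t ω => inner ℝ (S.act t ω) (S.pred t ω - f (x t)) with hu
  set X : ℕ → Ω → ℝ := fun t ω =>
    g t ω * (inner ℝ (S.act t ω) (S.pred t ω) - S.loss t ω) ^ 2 with hX
  set Y : ℕ → Ω → ℝ := fun t ω =>
    g t ω * (inner ℝ (S.act t ω) (f (x t)) - S.loss t ω) ^ 2 with hY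
  set B : ℕ → ℝ := supError f μ x 𝒜
  have hg0 : ∀ t < T, ∀ ω, 0 ≤ g t ω := fun t ht ω =>
    mul_nonneg (hS.impWeight_nonneg ht m ω) (hS.gamma_pos hd ht m ω).le
  have hgm : ∀ t < T, Measurable[S.afterSelect t] (g t) := by
    intro t ht
    have h1 := hS.measurable_impWeight ht m
    have h2 := (hS.measurable_gamma ht m).mono (S.ℱ_le_afterSelect t) le_rfl
    let := S.afterSelect t
    exact Measurable.mul h1 h2
  have hum : ∀ t < T, Measurable[S.afterAct t] (u t) := by
    intro t ht
    have h1 := (S.measurable_pred_afterPred t).mono (S.afterPred_le_afterAct t) le_rfl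
    have h2 := S.measurable_act_afterAct t
    let := S.afterAct t
    exact Measurable.inner h2 (Measurable.sub_const h1 _)
  have hgm' : ∀ t < T, Measurable (g t) := fun t ht =>
    (hgm t ht).mono (hS.afterSelect_le ht) le_rfl
  have hum' : ∀ t < T, Measurable (u t) := fun t ht => (hum t ht).mono (hS.afterAct_le ht) le_rfl
  have hXm : ∀ t < T, Measurable (X t) := fun t ht => by
    have h1 := hS.measurable_pred t ht
    have h2 := hS.measurable_act t ht
    have h3 := hS.measurable_loss t ht
    exact (hgm' t ht).mul (((h2.inner h1).sub h3).pow_const 2)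
  have hYm : ∀ t < T, Measurable (Y t) := fun t ht => by
    have h2 := hS.measurable_act t ht
    have h3 := hS.measurable_loss t ht
    exact (hgm' t ht).mul (((h2.inner measurable_const).sub h3).pow_const 2)
  have hX0 : ∀ t < T, ∀ ω, 0 ≤ X t ω := fun t ht ω => mul_nonneg (hg0 t ht ω) (sq_nonneg _)
  have hY0 : ∀ t < T, ∀ ω, 0 ≤ Y t ω := fun t ht ω => mul_nonneg (hg0 t ht ω) (sq_nonneg _)
  have hball : ∀ t < T, ∀ ω, S.act t ω ∈ Metric.closedBall (0 : E d) 1 := fun t ht ω =>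
    h𝒜 t ht (hS.act_mem t ht ω)
  have hgi : ∀ t < T, Integrable (g t) P := fun t ht =>
    (hS.integrable_impWeight_mul_gamma hd ht m).1
  have hYi : ∀ t < T, Integrable (Y t) P := by
    intro t ht
    refine ((hgi t ht).mul_const ((‖f (x t)‖ + 1) ^ 2)).mono' (hYm t ht).aestronglyMeasurable
      (.of_forall fun ω => ?_)
    rw [Real.norm_of_nonneg (hY0 t ht ω)]
    refine mul_le_mul_of_nonneg_left ?_ (hg0 t ht ω)
    have h1 := abs_le.1 (abs_inner_le_of_mem_ball (hball t ht ω) (f (x t)))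
    have h2 := hS.loss_mem t ht ω
    exact sq_le_sq' (by linarith [h2.2]) (by linarith [h2.1])
  -- all the expectations in the regret bound of the oracle are finite
  have hYs : Integrable (fun ω => ∑ t ∈ Finset.range T, Y t ω) P :=
    integrable_finsetSum _ fun t ht => hYi t (Finset.mem_range.1 ht)
  have hYs0 : ∀ ω, 0 ≤ ∑ t ∈ Finset.range T, Y t ω := fun ω =>
    Finset.sum_nonneg fun t ht => hY0 t (Finset.mem_range.1 ht) ω
  have hXs0 : ∀ ω, 0 ≤ ∑ t ∈ Finset.range T, X t ω := fun ω =>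
    Finset.sum_nonneg fun t ht => hX0 t (Finset.mem_range.1 ht) ω
  have hXsm : Measurable (fun ω => ∑ t ∈ Finset.range T, X t ω) :=
    Finset.measurable_sum _ fun t ht => hXm t (Finset.mem_range.1 ht)
  have hYfin : ∫⁻ ω, ENNReal.ofReal (∑ t ∈ Finset.range T, Y t ω) ∂P ≠ ⊤ :=
    ((hasFiniteIntegral_iff_ofReal (.of_forall hYs0)).1 hYs.2).ne
  have hXs : Integrable (fun ω => ∑ t ∈ Finset.range T, X t ω) P := by
    refine ⟨hXsm.aestronglyMeasurable, ?_⟩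
    rw [hasFiniteIntegral_iff_ofReal (.of_forall hXs0)]
    exact hreg.trans_lt (ENNReal.add_lt_top.2 ⟨hYfin.lt_top, lt_top_iff_ne_top.2 hCt⟩)
  have hXi : ∀ t < T, Integrable (X t) P := fun t ht => by
    refine hXs.mono' (hXm t ht).aestronglyMeasurable (.of_forall fun ω => ?_)
    rw [Real.norm_of_nonneg (hX0 t ht ω)]
    exact Finset.single_le_sum (f := fun t => X t ω)
      (fun t ht => hX0 t (Finset.mem_range.1 ht) ω) (Finset.mem_range.2 ht)
  have hregR : ∑ t ∈ Finset.range T, ∫ ω, X t ω ∂P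
      ≤ ∑ t ∈ Finset.range T, ∫ ω, Y t ω ∂P + C.toReal := by
    rw [← integral_finsetSum _ fun t ht => hXi t (Finset.mem_range.1 ht),
      ← integral_finsetSum _ fun t ht => hYi t (Finset.mem_range.1 ht),
      integral_eq_lintegral_of_nonneg_ae (.of_forall hXs0) hXs.1,
      integral_eq_lintegral_of_nonneg_ae (.of_forall hYs0) hYs.1,
      ← ENNReal.toReal_add hYfin hCt]
    exact ENNReal.toReal_mono (ENNReal.add_ne_top.2 ⟨hYfin, hCt⟩) hreg
  have hVi : ∀ t < T, Integrable (fun ω => g t ω * u t ω ^ 2) P := by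
    intro t ht
    refine (((hXi t ht).const_mul 2).add ((hYi t ht).const_mul 2)).mono'
      ((hgm' t ht).mul ((hum' t ht).pow_const 2)).aestronglyMeasurable (.of_forall fun ω => ?_)
    rw [Real.norm_of_nonneg (mul_nonneg (hg0 t ht ω) (sq_nonneg _))]
    have e : u t ω = (inner ℝ (S.act t ω) (S.pred t ω) - S.loss t ω)
        - (inner ℝ (S.act t ω) (f (x t)) - S.loss t ω) := by
      simp only [hu, inner_sub_right]; ring
    have h1 := sq_nonneg ((inner ℝ (S.act t ω) (S.pred t ω) - S.loss t ω)
        + (inner ℝ (S.act t ω) (f (x t)) - S.loss t ω))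
    have h2 := mul_nonneg (hg0 t ht ω) h1
    simp only [Pi.add_apply, hX, hY, e]
    nlinarith
  have hround : ∀ t < T, 1 / 2 * ∫ ω, g t ω * u t ω ^ 2 ∂P
      ≤ ∫ ω, X t ω ∂P - ∫ ω, Y t ω ∂P + 2 * (√d / gridEps m * B t ^ 2) := by
    intro t ht
    have hZsm : StronglyMeasurable[S.afterAct t] fun ω => g t ω * u t ω := by
      have h1 := (hgm t ht).mono
        ((S.afterSelect_le_afterPred t).trans (S.afterPred_le_afterAct t)) le_rfl
      have h2 := hum t ht
      let := S.afterAct t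
      exact (Measurable.mul h1 h2).stronglyMeasurable
    have hZi : Integrable (fun ω => g t ω * u t ω) P := by
      refine ((hgi t ht).add (hVi t ht)).mono'
        ((hgm' t ht).mul (hum' t ht)).aestronglyMeasurable (.of_forall fun ω => ?_)
      have h1 : |u t ω| ≤ 1 + u t ω ^ 2 := by
        rw [← sq_abs]; nlinarith [sq_nonneg (|u t ω| - 1), abs_nonneg (u t ω)]
      rw [Real.norm_eq_abs, abs_mul, abs_of_nonneg (hg0 t ht ω)]
      have := mul_le_mul_of_nonneg_left h1 (hg0 t ht ω)
      simp only [Pi.add_apply]; linarith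
    have hli : Integrable (S.loss t) P :=
      Integrable.of_bound (hS.measurable_loss t ht).aestronglyMeasurable 1
        (.of_forall fun ω => abs_le.2 (hS.loss_mem t ht ω))
    have hZl : Integrable (fun ω => g t ω * u t ω * S.loss t ω) P :=
      hZi.mul_bdd (hS.measurable_loss t ht).aestronglyMeasurable
        (.of_forall fun ω => abs_le.2 (hS.loss_mem t ht ω))
    have hμm : AEStronglyMeasurable (fun ω => μ (S.act t ω) (x t)) P :=
      integrable_condExp.1.congr (hS.loss_mean t ht)
    have hZμ : Integrable (fun ω => g t ω * u t ω * μ (S.act t ω) (x t)) P :=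
      hZi.mul_bdd hμm (.of_forall fun ω => abs_le.2 (hμ _ (hball t ht ω) _))
    have hZf : Integrable (fun ω => g t ω * u t ω * inner ℝ (S.act t ω) (f (x t))) P :=
      hZi.mul_bdd ((hS.measurable_act t ht).inner measurable_const).aestronglyMeasurable
        (.of_forall fun ω => abs_inner_le_of_mem_ball (hball t ht ω) (f (x t)))
    -- the loss is replaced by its conditional mean
    have hmean : ∫ ω, g t ω * u t ω * S.loss t ω ∂P
        = ∫ ω, g t ω * u t ω * μ (S.act t ω) (x t) ∂P := by
      rw [← integral_condExp (hS.afterAct_le ht)]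
      refine integral_congr_ae ?_
      filter_upwards [condExp_mul_of_stronglyMeasurable_left hZsm hZl hli, hS.loss_mean t ht]
        with ω h1 h2
      exact h1.trans (congrArg (g t ω * u t ω * ·) h2)
    have hXY : ∫ ω, X t ω ∂P - ∫ ω, Y t ω ∂P = ∫ ω, g t ω * u t ω ^ 2 ∂P
        + 2 * (∫ ω, g t ω * u t ω * inner ℝ (S.act t ω) (f (x t)) ∂P
          - ∫ ω, g t ω * u t ω * S.loss t ω ∂P) := by
      have hD : Integrable (fun ω => 2 * (g t ω * u t ω * inner ℝ (S.act t ω) (f (x t))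
          - g t ω * u t ω * S.loss t ω)) P := (hZf.sub hZl).const_mul 2
      rw [← integral_sub (hXi t ht) (hYi t ht), ← integral_sub hZf hZl, ← integral_const_mul,
        ← integral_add (hVi t ht) hD]
      refine integral_congr_ae (.of_forall fun ω => ?_)
      simp only [hX, hY, hu, inner_sub_right]; ring
    have hdiff : ∫ ω, g t ω * u t ω ^ 2 ∂P
        + 2 * (∫ ω, g t ω * u t ω * inner ℝ (S.act t ω) (f (x t)) ∂P
          - ∫ ω, g t ω * u t ω * μ (S.act t ω) (x t) ∂P)
        - 1 / 2 * ∫ ω, g t ω * u t ω ^ 2 ∂P + 2 * B t ^ 2 * ∫ ω, g t ω ∂P ≥ 0 := by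
      have hD : Integrable (fun ω => 2 * (g t ω * u t ω * inner ℝ (S.act t ω) (f (x t))
          - g t ω * u t ω * μ (S.act t ω) (x t))) P := (hZf.sub hZμ).const_mul 2
      have hD₂ : Integrable (fun ω => g t ω * u t ω ^ 2
          + 2 * (g t ω * u t ω * inner ℝ (S.act t ω) (f (x t))
            - g t ω * u t ω * μ (S.act t ω) (x t))) P := (hVi t ht).add hD
      have hD₃ : Integrable (fun ω => g t ω * u t ω ^ 2
          + 2 * (g t ω * u t ω * inner ℝ (S.act t ω) (f (x t))
            - g t ω * u t ω * μ (S.act t ω) (x t)) - 1 / 2 * (g t ω * u t ω ^ 2)) P :=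
        hD₂.sub ((hVi t ht).const_mul _)
      rw [← integral_sub hZf hZμ, ← integral_const_mul, ← integral_const_mul, ← integral_const_mul,
        ← integral_add (hVi t ht) hD, ← integral_sub hD₂ ((hVi t ht).const_mul _),
        ← integral_add hD₃ ((hgi t ht).const_mul _)]
      refine integral_nonneg fun ω => ?_
      set e := (inner ℝ (S.act t ω) (f (x t)) : ℝ) - μ (S.act t ω) (x t) with he
      have h1 : |e| ≤ B t := abs_error_le hμ (h𝒜 t ht) f (hS.act_mem t ht ω)
      have h2 : e ^ 2 ≤ B t ^ 2 := sq_le_sq' (abs_le.1 h1).1 (abs_le.1 h1).2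
      have h3 : 0 ≤ g t ω * (1 / 2 * (u t ω + 2 * e) ^ 2 + 2 * (B t ^ 2 - e ^ 2)) :=
        mul_nonneg (hg0 t ht ω) (by nlinarith [sq_nonneg (u t ω + 2 * e)])
      have h4 : g t ω * (1 / 2 * (u t ω + 2 * e) ^ 2 + 2 * (B t ^ 2 - e ^ 2))
          = g t ω * u t ω ^ 2 + 2 * (g t ω * u t ω * inner ℝ (S.act t ω) (f (x t))
            - g t ω * u t ω * μ (S.act t ω) (x t)) - 1 / 2 * (g t ω * u t ω ^ 2)
            + 2 * B t ^ 2 * g t ω := by rw [he]; ring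
      exact h4 ▸ h3
    have hgb := (hS.integrable_impWeight_mul_gamma hd ht m).2
    have hgb' := mul_le_mul_of_nonneg_left hgb (by positivity : 0 ≤ 2 * B t ^ 2)
    rw [hXY, hmean]
    simp only [hg] at hdiff hgb' ⊢
    linarith
  have hsum : 1 / 4 * ∑ t ∈ Finset.range T, ∫ ω, g t ω * u t ω ^ 2 ∂P
      ≤ 1 / 2 * C.toReal + √d / gridEps m * ∑ t ∈ Finset.range T, B t ^ 2 := by
    have := Finset.sum_le_sum fun t ht => hround t (Finset.mem_range.1 ht)
    rw [← Finset.mul_sum, Finset.sum_add_distrib, Finset.sum_sub_distrib, ← Finset.mul_sum,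
      ← Finset.mul_sum] at this
    linarith
  have hlin : ∀ t ∈ Finset.range T, ∫⁻ ω, ENNReal.ofReal (g t ω * u t ω ^ 2) ∂P
      = ENNReal.ofReal (∫ ω, g t ω * u t ω ^ 2 ∂P) := fun t ht =>
    (ofReal_integral_eq_lintegral_ofReal (hVi t (Finset.mem_range.1 ht)) (.of_forall fun ω =>
      mul_nonneg (hg0 t (Finset.mem_range.1 ht) ω) (sq_nonneg _))).symm
  have hVnn : ∀ t ∈ Finset.range T, 0 ≤ ∫ ω, g t ω * u t ω ^ 2 ∂P := fun t ht =>
    integral_nonneg fun ω => mul_nonneg (hg0 t (Finset.mem_range.1 ht) ω) (sq_nonneg _)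
  rw [Finset.sum_congr rfl hlin, ← ENNReal.ofReal_sum_of_nonneg hVnn,
    ← ENNReal.ofReal_mul (by norm_num), ← ENNReal.ofReal_toReal hCt,
    ← ENNReal.ofReal_mul (by norm_num), ← ENNReal.ofReal_add (by positivity)
      (mul_nonneg (div_nonneg (Real.sqrt_nonneg _) (gridEps_pos m).le)
        (Finset.sum_nonneg fun t _ => sq_nonneg _))]
  exact ENNReal.ofReal_le_ofReal hsum

/-! ### The importance-weighted regret -/

omit hS in
theorem regImp_eq_zero_of_dim_zero {S : Scheme Ω 0 M} {orc : WeightedOracle 𝒳 0} {μ : E 0 → 𝒳 → ℝ}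
    {𝒜 : ℕ → Set (E 0)} (hS : S.IsRun P orc T R μ x 𝒜) (m : Fin M) :
    S.regImp P T μ x 𝒜 m = 0 := by
  unfold regImp
  have : ∀ ω, ∑ t ∈ Finset.range T, (if S.A t ω = m then 1 else 0) / S.q t ω m *
      (μ (S.act t ω) (x t) - ⨅ a : 𝒜 t, μ a.1 (x t)) = 0 := by
    intro ω
    refine Finset.sum_eq_zero fun t ht => ?_
    have : Nonempty (𝒜 t) := ⟨⟨_, hS.act_mem t (Finset.mem_range.1 ht) ω⟩⟩
    have e : ∀ a : 𝒜 t, μ a.1 (x t) = μ (S.act t ω) (x t) := fun a => by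
      rw [Subsingleton.elim a.1 (S.act t ω)]
    simp only [e, ciInf_const, sub_self, mul_zero]
  simp [this]

/-- The regret bound with the misspecification of a single function of the class. -/
theorem regImp_le_of_mem [IsProbabilityMeasure P] {F : Set (𝒳 → E d)}
    (horc : orc.HasRegret F T R) (hd : 0 < d) (hT : 0 < T)
    (hμ : ∀ a ∈ Metric.closedBall (0 : E d) 1, ∀ y, μ a y ∈ Set.Icc (-1 : ℝ) 1)
    (h𝒜 : ∀ t < T, 𝒜 t ⊆ Metric.closedBall (0 : E d) 1) (m : Fin M) {f : 𝒳 → E d} (hf : f ∈ F)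
    {ε : ℝ} (hε : ε = √((1 / (T : ℝ)) * ∑ t ∈ Finset.range T,
      ⨆ a : 𝒜 t, (inner ℝ a.1 (f (x t)) - μ a.1 (x t)) ^ 2)) :
    S.regImp P T μ x 𝒜 m ≤
      ENNReal.ofReal (3 / 2) * (∫⁻ ω, ENNReal.ofReal √(S.rho (T - 1) m ω) ∂P)
          * ENNReal.ofReal √(d * T * R)
        + ENNReal.ofReal (((gridEps m + ε ^ 2 / gridEps m) * √d + 2 * ε) * T) := by
  obtain ⟨hB2, hB1⟩ := sum_supError_le hT f μ x 𝒜 hε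
  have hε0 : 0 ≤ ε := hε ▸ Real.sqrt_nonneg _
  have hgrid := gridEps_pos m
  have hT' : (0 : ℝ) < T := by exact_mod_cast hT
  set B : ℕ → ℝ := supError f μ x 𝒜 with hB
  have hB0 : ∀ t, 0 ≤ B t := supError_nonneg f μ x 𝒜
  set J := ∫⁻ ω, ENNReal.ofReal √(S.rho (T - 1) m ω) ∂P with hJ
  have hκm : ∀ t < T, Measurable fun ω => ENNReal.ofReal (S.impWeight t m ω) := fun t ht =>
    ((hS.measurable_impWeight ht m).mono (hS.afterSelect_le ht) le_rfl).ennreal_ofReal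
  have hLm : ∀ t < T, Measurable fun ω => ENNReal.ofReal
      (inner ℝ (S.act t ω) (f (x t)) - ⨅ b : 𝒜 t, inner ℝ b.1 (f (x t))) := fun t ht =>
    (((hS.measurable_act t ht).inner measurable_const).sub_const _).ennreal_ofReal
  -- the regret is split into the regret for the linear losses of `f` and the error of `f`
  have h1 : S.regImp P T μ x 𝒜 m ≤ ∑ t ∈ Finset.range T,
      (∫⁻ ω, ENNReal.ofReal (S.impWeight t m ω) * ENNReal.ofReal
        (inner ℝ (S.act t ω) (f (x t)) - ⨅ b : 𝒜 t, inner ℝ b.1 (f (x t))) ∂P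
        + ENNReal.ofReal (2 * B t)) := by
    have e : ∀ t ∈ Finset.range T,
        ∫⁻ ω, ENNReal.ofReal (S.impWeight t m ω) * ENNReal.ofReal
          (inner ℝ (S.act t ω) (f (x t)) - ⨅ b : 𝒜 t, inner ℝ b.1 (f (x t))) ∂P
          + ENNReal.ofReal (2 * B t)
        = ∫⁻ ω, (ENNReal.ofReal (S.impWeight t m ω) * ENNReal.ofReal
          (inner ℝ (S.act t ω) (f (x t)) - ⨅ b : 𝒜 t, inner ℝ b.1 (f (x t)))
          + ENNReal.ofReal (S.impWeight t m ω) * ENNReal.ofReal (2 * B t)) ∂P := by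
      intro t ht
      have ht' := Finset.mem_range.1 ht
      have hm : Measurable fun ω => ENNReal.ofReal (S.impWeight t m ω) * ENNReal.ofReal
          (inner ℝ (S.act t ω) (f (x t)) - ⨅ b : 𝒜 t, inner ℝ b.1 (f (x t))) :=
        (hκm t ht').mul (hLm t ht')
      rw [lintegral_add_left hm, hS.lintegral_impWeight_mul ht' m
        (@measurable_const _ _ _ (S.ℱ t) _)]
      simp
    have hm : ∀ t ∈ Finset.range T, AEMeasurable (fun ω => ENNReal.ofReal (S.impWeight t m ω) *
        ENNReal.ofReal (inner ℝ (S.act t ω) (f (x t)) - ⨅ b : 𝒜 t, inner ℝ b.1 (f (x t)))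
        + ENNReal.ofReal (S.impWeight t m ω) * ENNReal.ofReal (2 * B t)) P := fun t ht =>
      (((hκm t (Finset.mem_range.1 ht)).mul (hLm t (Finset.mem_range.1 ht))).add
        ((hκm t (Finset.mem_range.1 ht)).mul_const _)).aemeasurable
    rw [Finset.sum_congr rfl e, ← lintegral_finsetSum' _ hm]
    refine lintegral_mono fun ω => (Finset.le_sum_of_subadditive ENNReal.ofReal
      ENNReal.ofReal_zero.le (fun a b => ENNReal.ofReal_add_le) _ _).trans
      (Finset.sum_le_sum fun t ht => ?_)
    have ht' := Finset.mem_range.1 ht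
    have hκ0 := hS.impWeight_nonneg ht' m ω
    change ENNReal.ofReal (S.impWeight t m ω * _) ≤ _
    rw [ENNReal.ofReal_mul hκ0, ← mul_add]
    refine mul_le_mul_right ?_ _
    exact (ENNReal.ofReal_le_ofReal (sub_iInf_le hμ (h𝒜 t ht') f (hS.act_mem t ht' ω))).trans
      ENNReal.ofReal_add_le
  -- the barrier turns linear regret into learning rates and squared prediction errors
  have h2 : ∀ t ∈ Finset.range T,
      ∫⁻ ω, ENNReal.ofReal (S.impWeight t m ω) * ENNReal.ofReal
        (inner ℝ (S.act t ω) (f (x t)) - ⨅ b : 𝒜 t, inner ℝ b.1 (f (x t))) ∂P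
        + ENNReal.ofReal (2 * B t)
      ≤ (ENNReal.ofReal (gridEps m * √d) + ENNReal.ofReal √(d * R / T) * J)
        + ENNReal.ofReal (1 / 4) * ∫⁻ ω, ENNReal.ofReal
          (S.impWeight t m ω * S.gamma T R t m ω *
            (inner ℝ (S.act t ω) (S.pred t ω - f (x t))) ^ 2) ∂P + ENNReal.ofReal (2 * B t) := by
    intro t ht
    have ht' := Finset.mem_range.1 ht
    refine add_le_add ((hS.lintegral_linear_regret_le hd ht' (h𝒜 t ht') m (f (x t))).trans
      (add_le_add ?_ le_rfl)) le_rfl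
    calc ∫⁻ ω, ENNReal.ofReal (d / S.gamma T R t m ω) ∂P
        ≤ ∫⁻ ω, (ENNReal.ofReal (gridEps m * √d)
            + ENNReal.ofReal √(d * R / T) * ENNReal.ofReal √(S.rho (T - 1) m ω)) ∂P := by
          refine lintegral_mono fun ω => ?_
          rw [← ENNReal.ofReal_mul (Real.sqrt_nonneg _), ← ENNReal.ofReal_add (by positivity)
            (by positivity)]
          exact ENNReal.ofReal_le_ofReal (hS.div_gamma_le ht' m ω)
      _ = _ := by
          rw [lintegral_add_left measurable_const, lintegral_const_mul' _ _ ENNReal.ofReal_ne_top]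
          simp [hJ]
  refine (h1.trans (Finset.sum_le_sum h2)).trans ?_
  rw [Finset.sum_add_distrib, Finset.sum_add_distrib, ← Finset.mul_sum, Finset.sum_const,
    Finset.card_range, nsmul_eq_mul, ← ENNReal.ofReal_sum_of_nonneg
      fun t _ => mul_nonneg zero_le_two (hB0 t), ← Finset.mul_sum]
  refine (add_le_add (add_le_add le_rfl
    (hS.sum_lintegral_sq_le horc hd hμ h𝒜 m hf)) le_rfl).trans ?_
  rw [← hB, ← hJ, hB2]
  have hTof : (T : ℝ≥0∞) = ENNReal.ofReal T := (ENNReal.ofReal_natCast T).symm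
  have hs : T * √(d * R / T) = √(d * T * R) := by
    rw [← Real.sqrt_sq hT'.le, ← Real.sqrt_mul (by positivity), Real.sqrt_sq hT'.le]
    congr 1; field_simp
  have e1 : (T : ℝ≥0∞) * (ENNReal.ofReal (gridEps m * √d) + ENNReal.ofReal √(d * R / T) * J)
      = ENNReal.ofReal (T * (gridEps m * √d)) + J * ENNReal.ofReal √(d * T * R) := by
    rw [mul_add, ← mul_assoc, hTof, ← ENNReal.ofReal_mul hT'.le, ← ENNReal.ofReal_mul hT'.le, hs,
      mul_comm J]
  have e2 : ENNReal.ofReal (3 / 2) = 1 + ENNReal.ofReal (1 / 2) := by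
    rw [← ENNReal.ofReal_one, ← ENNReal.ofReal_add (by norm_num) (by norm_num)]; norm_num
  have e3 : ENNReal.ofReal (((gridEps m + ε ^ 2 / gridEps m) * √d + 2 * ε) * T)
      = ENNReal.ofReal (T * (gridEps m * √d)) + ENNReal.ofReal (√d / gridEps m * (T * ε ^ 2))
        + ENNReal.ofReal (2 * (T * ε)) := by
    rw [← ENNReal.ofReal_add (by positivity) (by positivity), ← ENNReal.ofReal_add (by positivity)
      (by positivity)]
    congr 1; ring
  rw [e1, e2, e3]
  refine (add_le_add le_rfl (ENNReal.ofReal_le_ofReal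
    (mul_le_mul_of_nonneg_left hB1 zero_le_two))).trans (le_of_eq ?_)
  ring

end Scheme.IsRun

end CorralCB

theorem theorem7 {𝒳 Ω : Type*} [MeasurableSpace 𝒳] [MeasurableSpace Ω]
    (P : Measure Ω) [IsProbabilityMeasure P]
    (d M T : ℕ) (hT : 0 < T)
    (F : Set (𝒳 → CorralCB.E d)) (hF : F.Nonempty)
    (μ : CorralCB.E d → 𝒳 → ℝ)
    (hμ : ∀ a ∈ Metric.closedBall (0 : CorralCB.E d) 1, ∀ y, μ a y ∈ Set.Icc (-1 : ℝ) 1)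
    (x : ℕ → 𝒳) (𝒜 : ℕ → Set (CorralCB.E d))
    (h𝒜_ne : ∀ t < T, (𝒜 t).Nonempty)
    (h𝒜_sub : ∀ t < T, 𝒜 t ⊆ Metric.closedBall (0 : CorralCB.E d) 1)
    (orc : CorralCB.WeightedOracle 𝒳 d) (R : ℝ≥0) (horc : orc.HasRegret F T R)
    (S : CorralCB.Scheme Ω d M) (hS : S.IsRun P orc T R μ x 𝒜) (m : Fin M) :
    S.regImp P T μ x 𝒜 m ≤
      ENNReal.ofReal (3 / 2) * (∫⁻ ω, ENNReal.ofReal √(S.rho (T - 1) m ω) ∂P)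
          * ENNReal.ofReal √(d * T * R)
        + ENNReal.ofReal
            (((CorralCB.gridEps m + CorralCB.misspec F μ T x 𝒜 ^ 2 / CorralCB.gridEps m) * √d
              + 2 * CorralCB.misspec F μ T x 𝒜) * T) := by
  rcases Nat.eq_zero_or_pos d with rfl | hd
  · rw [hS.regImp_eq_zero_of_dim_zero m]
    exact zero_le
  have hne : Nonempty F := hF.to_subtype
  set ε := CorralCB.misspec F μ T x 𝒜 with hε
  -- the bound for single functions is monotone and continuous in their misspecification
  have hε0 : 0 ≤ ε := Real.iInf_nonneg fun _ => Real.sqrt_nonneg _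
  have key : ∀ δ : ℝ, 0 < δ → S.regImp P T μ x 𝒜 m ≤
      ENNReal.ofReal (3 / 2) * (∫⁻ ω, ENNReal.ofReal √(S.rho (T - 1) m ω) ∂P)
          * ENNReal.ofReal √(d * T * R)
        + ENNReal.ofReal (((CorralCB.gridEps m + (ε + δ) ^ 2 / CorralCB.gridEps m) * √d
          + 2 * (ε + δ)) * T) := by
    intro δ hδ
    obtain ⟨f, hf⟩ := exists_lt_of_ciInf_lt (lt_add_of_pos_right ε hδ)
    refine (hS.regImp_le_of_mem horc hd hT hμ h𝒜_sub m f.2 rfl).trans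
      (add_le_add le_rfl (ENNReal.ofReal_le_ofReal ?_))
    have hgrid := CorralCB.gridEps_pos m
    gcongr
  have hlim : Filter.Tendsto (fun δ : ℝ =>
      ENNReal.ofReal (3 / 2) * (∫⁻ ω, ENNReal.ofReal √(S.rho (T - 1) m ω) ∂P)
          * ENNReal.ofReal √(d * T * R)
        + ENNReal.ofReal (((CorralCB.gridEps m + (ε + δ) ^ 2 / CorralCB.gridEps m) * √d
          + 2 * (ε + δ)) * T)) (nhdsWithin 0 (Set.Ioi 0))
      (nhds (ENNReal.ofReal (3 / 2) * (∫⁻ ω, ENNReal.ofReal √(S.rho (T - 1) m ω) ∂P)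
          * ENNReal.ofReal √(d * T * R)
        + ENNReal.ofReal (((CorralCB.gridEps m + ε ^ 2 / CorralCB.gridEps m) * √d
          + 2 * ε) * T))) := by
    have hc : Continuous (fun δ : ℝ =>
        ENNReal.ofReal (((CorralCB.gridEps m + (ε + δ) ^ 2 / CorralCB.gridEps m) * √d
          + 2 * (ε + δ)) * T)) := ENNReal.continuous_ofReal.comp (by fun_prop)
    have h := (hc.tendsto 0).mono_left (nhdsWithin_le_nhds (s := Set.Ioi 0))
    simp only [add_zero] at h
    exact tendsto_const_nhds.add h
  exact ge_of_tendsto hlim (by filter_upwards [self_mem_nhdsWithin] with δ hδ using key δ hδ)
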